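/- Conventions. A Boolean ring is an associative ring, not necessarily with identity, satisfying $a^2=a$ for all $a$ (the zero ring is allowed), and "countable" includes finite. Fix $n\ge 0$. A countable Boolean ring $R$ with distinguished (not necessarily distinct or proper) ideals $J_1,\dots,J_n$ is regarded as a first-order structure for the language of rings without identity together with $n$ unary predicates naming the ideals. It is *$\omega$-categorical* if every countable structure for this language that is elementarily equivalent to it is isomorphic to it. An isomorphism $(R,J_1,\dots,J_n)\to(R^*,J_1^*,\dots,J_n^*)$ is a ring isomorphism $R\to R^*$ mapping $J_i$ onto $J_i^*$ for each $i$. Let $X$ be the Stone space of $R$, whose compact open sets are identified with the elements of $R$, and let $C_i$ be the closed set $X\setminus\bigcup_{A\in J_i}A$. For $S\subseteq X$, $S'$ denotes the set of limit points of $S$. A *PO system* is a set $P$ (possibly empty) with a transitive antisymmetric relation $<$ (where $p<p$ may or may not hold). Put $P^d=\{p\in P: p\not< p\}$. A subset $L\subseteq P$ is *lower* if $p\in L$ and $q<p$ imply $q\in L$; $L_{\min}=\{p\in L: q\in L,\ q<p\Rightarrow q=p\}$ and $L^d_{\min}=L_{\min}\cap P^d$. An *extended PO system* $[P,L,f]$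 is a PO system $P$ with a lower subset $L$ and a function $f\colon L^d_{\min}\to\{1,2,3,\dots\}$; it is *finite-crowded* if $P$ is finite and $P^d\subseteq L_{\min}$. For $Q\subseteq P$ let $Q'=\{p\in P: p<q\text{ for some }q\in Q\}$. If $Y$ is a set whose power set $2^Y$ carries an operation $'$, then the sub-TBA $\langle\mathcal A,{}'\rangle$ of $2^Y$ generated by $\mathcal A\subseteq 2^Y$ is the smallest family of subsets of $Y$ that contains $\mathcal A$ and $Y$ and is closed under complements, finite unions and $'$. Let $\mathcal T_n$ be the class of tuples $[P,L,f,Q_1,\dots,Q_n]$ such that $[P,L,f]$ is a finite-crowded extended PO system, $Q_1,\dots,Q_n$ are lower subsets of $P$, and $\langle\{Q_1,\dots,Q_n\},{}'\rangle=2^P$. Two such tuples $[P_1,L_1,f_1,Q_{11},\dots,Q_{1n}]$ and $[P_2,L_2,f_2,Q_{21},\dots,Q_{2n}]$ are isomorphic if there is a bijection $\theta\colon P_1\to P_2$ with $p<q\Leftrightarrow\theta(p)<\theta(q)$, $\theta(L_1)=L_2$, $\theta(Q_{1j})=Q_{2j}$ for all $j$, and $f_2(\theta(p))=f_1(p)$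 for all $p$ in the domain of $f_1$. **Theorem.** There is a bijection between the isomorphism classes of countable $\omega$-categorical Boolean rings with $n$ distinguished ideals and the isomorphism classes of tuples in $\mathcal T_n$, under which the class of $(R,J_1,\dots,J_n)$ corresponds to the class of $[P,L,f,Q_1,\dots,Q_n]$ if and only if the atoms of the sub-TBA $\langle\{C_1,\dots,C_n\},{}'\rangle$ of $2^X$ can be labelled without repetition as $\{X_p: p\in P\}$ in such a way that 1. the $X_p$ form a partition of $X$ into non-empty sets, and $X_p'=\bigcup_{q<p}X_q$ for all $p\in P$; 2. $\overline{X_p}$ is compact if and only if $p\in L$; 3. $|X_p|=f(p)$ for all $p\in L^d_{\min}$; 4. $C_i=\bigcup_{p\in Q_i}X_p$ for $i=1,\dots,n$. -/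

import Mathlib

universe u v

namespace BooleanIdeals

/-! ### Rings with distinguished ideals as first-order structures -/

/-- Function symbols of the language of rings (not necessarily with identity): `0`, `-`, `+`, `*`. -/
inductive RngFunc : ℕ → Type
  | zero : RngFunc 0
  | neg : RngFunc 1
  | add : RngFunc 2
  | mul : RngFunc 2

/-- Relation symbols: one unary predicate for each of the `n` distinguished ideals. -/
inductive IdealRel (n : ℕ) : ℕ → Type
  | mem (i : Fin n) : IdealRel n 1

/-- The first-order language of rings with `n` distinguished ideals. -/
def idealLang (n : ℕ) : FirstOrder.Language.{0, 0} := ⟨RngFunc, IdealRel n⟩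

/-- A ring with `n` distinguished ideals, as a first-order structure. -/
@[reducible] def idealStructure {n : ℕ} {R : Type u} [NonUnitalRing R]
    (J : Fin n → TwoSidedIdeal R) : (idealLang n).Structure R where
  funMap := fun {k} (g : RngFunc k) =>
    match k, g with
    | _, RngFunc.zero => fun _ => 0
    | _, RngFunc.neg => fun x => -x 0
    | _, RngFunc.add => fun x => x 0 + x 1
    | _, RngFunc.mul => fun x => x 0 * x 1
  RelMap := fun {k} (r : IdealRel n k) =>
    match k, r with
    | _, IdealRel.mem i => fun x => x 0 ∈ J i

/-- `M` is determined up to isomorphism, among the countable structures for its language,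
by its first-order theory. (Used for countable `M`, possibly finite.) -/
def IsOmegaCategorical (𝓛 : FirstOrder.Language.{0, 0}) (M : Type u) [𝓛.Structure M] : Prop :=
  ∀ (N : Type u) [𝓛.Structure N], Countable N →
    𝓛.ElementarilyEquivalent M N → Nonempty (𝓛.Equiv M N)

/-- A Boolean ring, not necessarily with identity, with `n` distinguished ideals. -/
structure IdealSystem (n : ℕ) where
  carrier : Type u
  [ring : NonUnitalRing carrier]
  mul_self : ∀ a : carrier, a * a = a
  ideal : Fin n → TwoSidedIdeal carrier

attribute [instance] IdealSystem.ring

/-- A countable omega-categorical Boolean ring with `n` distinguished ideals. -/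
structure CatIdealSystem (n : ℕ) extends IdealSystem.{u} n where
  countable : Countable carrier
  categorical : @IsOmegaCategorical (idealLang n) carrier (idealStructure ideal)

/-- Isomorphism: a ring isomorphism carrying the `i`th ideal onto the `i`th ideal. -/
def IdealSystem.Iso {n : ℕ} (R S : IdealSystem.{u} n) : Prop :=
  ∃ e : R.carrier ≃+* S.carrier, ∀ i a, a ∈ R.ideal i ↔ e a ∈ S.ideal i

instance CatIdealSystem.isoSetoid (n : ℕ) : Setoid (CatIdealSystem.{u} n) where
  r R S := R.toIdealSystem.Iso S.toIdealSystem
  iseqv :=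
    { refl := fun _ => ⟨RingEquiv.refl _, fun _ _ => Iff.rfl⟩
      symm := fun {_ _} ⟨e, he⟩ => ⟨e.symm, fun i a => by simp [he]⟩
      trans := fun {_ _ _} ⟨e, he⟩ ⟨g, hg⟩ =>
        ⟨e.trans g, fun i a => (he i a).trans (hg i (e a))⟩ }

/-- Isomorphism classes of countable omega-categorical Boolean rings with `n` distinguished
ideals. -/
abbrev CatIdealClass (n : ℕ) : Type (u + 1) := Quotient (CatIdealSystem.isoSetoid.{u} n)

/-! ### Stone spaces -/

/-- The Stone space of a Boolean ring: the nonzero homomorphisms to the two-element field. -/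
def StoneSpace (R : Type u) [NonUnitalRing R] : Type u := {φ : R →ₙ+* ZMod 2 // φ ≠ 0}

/-- The (compact open) set of points corresponding to a ring element. -/
def StoneSpace.basicOpen {R : Type u} [NonUnitalRing R] (a : R) : Set (StoneSpace R) :=
  {φ | φ.1 a = 1}

instance StoneSpace.topology (R : Type u) [NonUnitalRing R] : TopologicalSpace (StoneSpace R) :=
  TopologicalSpace.generateFrom (Set.range StoneSpace.basicOpen)

/-- The closed set corresponding to an ideal: the complement of the union of the sets
`basicOpen a` over the elements `a` of the ideal. -/
def StoneSpace.closedSet {R : Type u} [NonUnitalRing R] (J : TwoSidedIdeal R) :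
    Set (StoneSpace R) :=
  (⋃ a ∈ J, StoneSpace.basicOpen a)ᶜ

/-! ### Generated topological Boolean algebras -/

/-- The members of the sub-TBA generated by `G` of the power set of `α`, where the power set
carries the derivative operation `d`. -/
inductive TBAGen {α : Type u} (d : Set α → Set α) (G : Set (Set α)) : Set α → Prop
  | basic {A : Set α} : A ∈ G → TBAGen d G A
  | univ : TBAGen d G Set.univ
  | compl {A : Set α} : TBAGen d G A → TBAGen d G Aᶜ
  | union {A B : Set α} : TBAGen d G A → TBAGen d G B → TBAGen d G (A ∪ B)
  | deriv {A : Set α} : TBAGen d G A → TBAGen d G (d A)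

/-- `A` is an atom of the Boolean algebra `𝒟` of sets. -/
def IsAtomOf {α : Type u} (𝒟 : Set α → Prop) (A : Set α) : Prop :=
  𝒟 A ∧ A.Nonempty ∧ ∀ B, 𝒟 B → B ⊆ A → B = ∅ ∨ B = A

/-! ### PO systems -/

/-- A PO system: a transitive antisymmetric relation. An element may or may not be related
to itself. -/
structure POSystem where
  carrier : Type v
  lt : carrier → carrier → Prop
  trans : ∀ p q r, lt p q → lt q r → lt p r
  antisymm : ∀ p q, lt p q → lt q p → p = q

namespace POSystem

variable (P : POSystem.{v})

/-- The elements `p` with `¬ p < p`. -/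
def discrete : Set P.carrier := {p | ¬ P.lt p p}

/-- Lower subsets. -/
def IsLower (L : Set P.carrier) : Prop := ∀ p ∈ L, ∀ q, P.lt q p → q ∈ L

/-- The minimal elements of a subset, for the partial order "`p < q` or `p = q`". -/
def minimals (L : Set P.carrier) : Set P.carrier := {p | p ∈ L ∧ ∀ q ∈ L, P.lt q p → q = p}

/-- The derivative operation on the subsets of `P`. -/
def deriv (Q : Set P.carrier) : Set P.carrier := {p | ∃ q ∈ Q, P.lt p q}

end POSystem

/-- An extended PO system `[P, L, f]`. -/
structure ExtPOSystem extends POSystem.{v} where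
  L : Set carrier
  lower_L : toPOSystem.IsLower L
  f : ↥(toPOSystem.minimals L ∩ toPOSystem.discrete) → ℕ+

/-- A finite-crowded extended PO system. -/
def ExtPOSystem.IsFiniteCrowded (E : ExtPOSystem.{v}) : Prop :=
  Finite E.carrier ∧ E.discrete ⊆ E.minimals E.L

/-- A tuple `[P, L, f, Q₁, …, Qₙ]`, with `[P, L, f]` a finite-crowded extended PO system and
`Q₁, …, Qₙ` lower subsets of `P` generating the TBA of all subsets of `P`. -/
structure POTuple (n : ℕ) extends ExtPOSystem.{v} where
  finiteCrowded : toExtPOSystem.IsFiniteCrowded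
  Q : Fin n → Set carrier
  lower_Q : ∀ i, toPOSystem.IsLower (Q i)
  generates : ∀ A : Set carrier, TBAGen toPOSystem.deriv (Set.range Q) A

/-- Isomorphism of tuples: an order isomorphism carrying `L`, `f` and each `Qᵢ` to their
counterparts. -/
def POTuple.Iso {n : ℕ} (s t : POTuple.{v} n) : Prop :=
  ∃ θ : s.lt ≃r t.lt,
    (∀ p, p ∈ s.L ↔ θ p ∈ t.L) ∧ (∀ i p, p ∈ s.Q i ↔ θ p ∈ t.Q i) ∧
    ∀ p (h : p ∈ s.minimals s.L ∩ s.discrete) (h' : θ p ∈ t.minimals t.L ∩ t.discrete),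
      t.f ⟨θ p, h'⟩ = s.f ⟨p, h⟩

/-- The domain of `f` is preserved automatically. -/
theorem POTuple.mem_dom_iff {n : ℕ} {s t : POTuple.{v} n} (θ : s.lt ≃r t.lt)
    (hL : ∀ p, p ∈ s.L ↔ θ p ∈ t.L) (p : s.carrier) :
    p ∈ s.minimals s.L ∩ s.discrete ↔ θ p ∈ t.minimals t.L ∩ t.discrete := by
  simp only [POSystem.minimals, POSystem.discrete, Set.mem_inter_iff, Set.mem_ofPred_eq,
    θ.map_rel_iff, hL]
  refine and_congr_left fun _ => and_congr_right fun _ =>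
    ⟨fun h q hq hlt => ?_, fun h q hq hlt => ?_⟩
  · obtain ⟨q, rfl⟩ := θ.surjective q
    exact congrArg θ (h q hq (θ.map_rel_iff.1 hlt))
  · exact θ.injective (h _ hq (θ.map_rel_iff.2 hlt))

instance POTuple.isoSetoid (n : ℕ) : Setoid (POTuple.{v} n) where
  r := POTuple.Iso
  iseqv :=
    { refl := fun _ => ⟨RelIso.refl _, fun _ => Iff.rfl, fun _ _ => Iff.rfl, fun _ _ _ => rfl⟩
      symm := fun {s t} ⟨θ, hL, hQ, hf⟩ => by
        refine ⟨θ.symm, fun p => by simp [hL], fun i p => by simp [hQ], fun p h h' => ?_⟩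
        have h2 : θ (θ.symm p) ∈ t.minimals t.L ∩ t.discrete := by simpa using h
        rw [← hf _ h' h2]
        congr 2
        simp
      trans := fun {s t w} ⟨θ, hL, hQ, hf⟩ ⟨η, kL, kQ, kf⟩ =>
        ⟨θ.trans η, fun p => (hL p).trans (kL _), fun i p => (hQ i p).trans (kQ i _),
          fun p h h' =>
            have h2 := (POTuple.mem_dom_iff θ hL p).1 h
            (kf _ h2 h').trans (hf p h h2)⟩ }

/-- Isomorphism classes of tuples. -/
abbrev POTupleClass (n : ℕ) : Type (v + 1) := Quotient (POTuple.isoSetoid.{v} n)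

/-! ### Complete partitions and the correspondence -/

/-- `{X p | p ∈ P}` is a partition of the space (into nonempty sets, with distinct labels for
distinct parts) such that the derived set of `X p` is the union of the `X q` with `q < p`. -/
structure IsCompletePartition (P : POSystem.{v}) {T : Type u} [TopologicalSpace T]
    (X : P.carrier → Set T) : Prop where
  nonempty : ∀ p, (X p).Nonempty
  disjoint : Pairwise fun p q => Disjoint (X p) (X q)
  cover : ⋃ p, X p = Set.univ
  derived : ∀ p, derivedSet (X p) = ⋃ q ∈ {q | P.lt q p}, X q

/-- A complete `[P, L, f]`-partition. -/
structure IsCompleteExtPartition (E : ExtPOSystem.{v}) {T : Type u} [TopologicalSpace T]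
    (X : E.carrier → Set T) : Prop extends IsCompletePartition E.toPOSystem X where
  compact_iff : ∀ p, IsCompact (closure (X p)) ↔ p ∈ E.L
  card_eq : ∀ p : ↥(E.minimals E.L ∩ E.discrete), (X p).encard = ((E.f p : ℕ) : ℕ∞)

/-- The tuple `t = [P, L, f, Q₁, …, Qₙ]` describes the Boolean ring with ideals `S`: with
`C₁, …, Cₙ` the closed subsets of the Stone space corresponding to the ideals, the atoms of the
sub-TBA generated by the `Cᵢ` can be labelled by `P` so as to form a complete
`[P, L, f]`-partition for which each `Cᵢ` is the union of the parts with label in `Qᵢ`. -/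
def Describes {n : ℕ} (t : POTuple.{v} n) (S : IdealSystem.{u} n) : Prop :=
  ∃ X : t.carrier → Set (StoneSpace S.carrier),
    IsCompleteExtPartition t.toExtPOSystem X ∧
    (∀ A, IsAtomOf (TBAGen derivedSet (Set.range fun i => StoneSpace.closedSet (S.ideal i))) A ↔
      A ∈ Set.range X) ∧
    ∀ i, StoneSpace.closedSet (S.ideal i) = ⋃ p ∈ t.Q i, X p

end BooleanIdeals

/-!
The correspondence sends a ring with ideals to the set of atoms of the algebra generated by its
closed sets. By `describes_iff`, the condition that the parts are exactly these atoms may be dropped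
from `Describes`: as the sets `Q i` generate all subsets of `P`, the sets `C i` generate all unions of
parts. It then remains to prove four things.

* *An omega-categorical ring is described by some tuple* (`CatIdealSystem.exists_describes`). By the
  Ryll-Nardzewski theorem (`IsOmegaCategorical.finite_orbits`) its automorphisms have finitely many
  orbits of elements. An invariant closed set is determined by the orbits of the compact open sets
  which miss it, so there are finitely many of them; as derivatives are closed, the algebra is
  finite. An infinite discrete invariant set would meet compact open sets in any finite number of
  points, which would give infinitely many orbits. So the discrete atoms are finite, and the atoms
  form a finite-crowded system, where `q < p` means that `X q` lies in the derivative of `X p`; this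
  is antisymmetric since two atoms that lie in the derivatives of each other are not separated by any
  member of the algebra (`exists_tuple`).
* *A tuple describes at most one countable ring, and the described rings are omega-categorical*
  (`Describes.iso_right`, `Describes.categorical`). Call two sets similar if they meet the same parts,
  in equally many points where the part is discrete, and with relatively compact traces on the same
  parts. If two clopen sets are similar, then every splitting of one by a compact open set is matched
  by a splitting of the other (`Similar.split`). Back and forth along enumerations of the rings, this
  produces an isomorphism, and shows that `k`-tuples cutting the space into similar cells are
  conjugate under automorphisms. As there are finitely many similarity types of `k`-tuples, the easy
  half of the Ryll-Nardzewski theorem applies (`isOmegaCategorical_of_orbits`).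
* *Every tuple describes some countable ring* (`exists_describes`). The points of the space are the
  sequences of labels that increase weakly, a path belonging to the part of its eventual label, and a
  second kind of step to a label `p < p` makes such parts crowded. The number of starting points
  controls the cardinality and the compactness of the parts.
* *Isomorphic rings have the same tuples, and the tuple of a ring is unique up to isomorphism*
  (`Describes.of_iso`, `Describes.iso_left`, `Describes.of_iso_left`).

The Ryll-Nardzewski theorem is proved in the direction needed as follows. An ultrapower shows that an
omega-categorical structure realizes every finitely satisfiable type over the empty set
(`IsOmegaCategorical.exists_realize`); hence isolated types are dense, an elementary substructure
exists in which all types are isolated, and it is isomorphic to the whole structure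
(`IsOmegaCategorical.isolated`). By the first property again, finitely many isolating formulas suffice
for each arity.
-/

universe w

namespace BooleanIdeals
open Set TopologicalSpace

/-! ### Stone spaces of Boolean rings -/

section Stone

variable {R : Type u} [NonUnitalRing R]

theorem zmod_two_eq_one_iff : ∀ x : ZMod 2, x = 1 ↔ x ≠ 0 := by decide

/-- The homomorphism to the two-element field that is the indicator of a predicate. -/
noncomputable def homOfPred (p : R → Prop) (hmul : ∀ a b, p (a * b) ↔ p a ∧ p b)
    (hadd : ∀ a b, p (a + b) ↔ ¬(p a ↔ p b)) : R →ₙ+* ZMod 2 := by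
  classical
  exact
  { toFun := fun a => if p a then 1 else 0
    map_mul' := fun a b => by by_cases ha : p a <;> by_cases hb : p b <;> simp [ha, hb, hmul]
    map_zero' := by
      have := hadd 0 0
      simp only [add_zero, not_true_eq_false, iff_false] at this
      simp [this]
    map_add' := fun a b => by
      by_cases ha : p a <;> by_cases hb : p b <;> simp [ha, hb, hadd]
      decide }

theorem homOfPred_eq_one {p : R → Prop} (hmul : ∀ a b, p (a * b) ↔ p a ∧ p b)
    (hadd : ∀ a b, p (a + b) ↔ ¬(p a ↔ p b)) (a : R) : homOfPred p hmul hadd a = 1 ↔ p a := by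
  classical
  change (if p a then (1 : ZMod 2) else 0) = 1 ↔ p a
  simp

/-- The point of the Stone space given by a predicate on the ring. -/
noncomputable def pointOfPred (p : R → Prop) (hmul : ∀ a b, p (a * b) ↔ p a ∧ p b)
    (hadd : ∀ a b, p (a + b) ↔ ¬(p a ↔ p b)) (hne : ∃ a, p a) : StoneSpace R :=
  ⟨homOfPred p hmul hadd, fun h => by
    obtain ⟨a, ha⟩ := hne
    have := (homOfPred_eq_one hmul hadd a).2 ha
    rw [h] at this
    exact absurd this (by simp)⟩

open StoneSpace

theorem mem_basicOpen {x : StoneSpace R} {a : R} : x ∈ basicOpen a ↔ x.1 a = 1 := Iff.rfl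

theorem pointOfPred_mem {p : R → Prop} (hmul : ∀ a b, p (a * b) ↔ p a ∧ p b)
    (hadd : ∀ a b, p (a + b) ↔ ¬(p a ↔ p b)) (hne : ∃ a, p a) (a : R) :
    pointOfPred p hmul hadd hne ∈ basicOpen a ↔ p a := homOfPred_eq_one hmul hadd a

theorem stone_ext {x y : StoneSpace R} (h : ∀ a, x ∈ basicOpen a ↔ y ∈ basicOpen a) : x = y := by
  refine Subtype.ext (NonUnitalRingHom.ext fun a => ?_)
  have := h a
  simp only [basicOpen, mem_ofPred_eq] at this
  revert this
  generalize x.1 a = s; generalize y.1 a = t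
  revert s t; decide

theorem mem_basicOpen_mul (x : StoneSpace R) (a b : R) :
    x ∈ basicOpen (a * b) ↔ x ∈ basicOpen a ∧ x ∈ basicOpen b := by
  simp only [mem_basicOpen, map_mul]
  generalize x.1 a = s; generalize x.1 b = t
  revert s t; decide

theorem mem_basicOpen_add (x : StoneSpace R) (a b : R) :
    x ∈ basicOpen (a + b) ↔ ¬(x ∈ basicOpen a ↔ x ∈ basicOpen b) := by
  simp only [mem_basicOpen, map_add]
  generalize x.1 a = s; generalize x.1 b = t
  revert s t; decide

theorem notMem_basicOpen_zero (x : StoneSpace R) : x ∉ basicOpen (0 : R) := by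
  simp [mem_basicOpen]

/-- The join of two elements of a Boolean ring. -/
def join (a b : R) : R := a + b + a * b

theorem basicOpen_join (a b : R) : basicOpen (join a b) = basicOpen a ∪ basicOpen b := by
  ext x
  simp only [join, mem_basicOpen_add, mem_basicOpen_mul, mem_union]
  tauto

/-- The difference of two elements of a Boolean ring. -/
def diff (a b : R) : R := a + a * b

theorem basicOpen_diff (a b : R) : basicOpen (diff a b) = basicOpen a \ basicOpen b := by
  ext x
  simp only [diff, mem_basicOpen_add, mem_basicOpen_mul, mem_sdiff]
  tauto

theorem basicOpen_mul (a b : R) : basicOpen (a * b) = basicOpen a ∩ basicOpen b := by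
  ext x
  exact mem_basicOpen_mul x a b

theorem exists_mem_basicOpen (x : StoneSpace R) : ∃ a, x ∈ basicOpen a := by
  by_contra! h
  refine x.2 (NonUnitalRingHom.ext fun a => ?_)
  by_contra h2
  exact h a ((zmod_two_eq_one_iff _).2 h2)

variable (R) in
theorem isTopologicalBasis_basicOpen :
    IsTopologicalBasis (range (basicOpen : R → Set (StoneSpace R))) where
  exists_subset_inter := by
    rintro _ ⟨a, rfl⟩ _ ⟨b, rfl⟩ x hx
    exact ⟨_, ⟨a * b, rfl⟩, by rwa [basicOpen_mul], by rw [basicOpen_mul]⟩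
  sUnion_eq := by
    refine eq_univ_of_forall fun x => ?_
    obtain ⟨a, ha⟩ := exists_mem_basicOpen x
    exact ⟨_, ⟨a, rfl⟩, ha⟩
  eq_generateFrom := rfl

theorem isOpen_basicOpen (a : R) : IsOpen (basicOpen a) :=
  (isTopologicalBasis_basicOpen R).isOpen ⟨a, rfl⟩

theorem exists_basicOpen_subset {U : Set (StoneSpace R)} (hU : IsOpen U) {x : StoneSpace R}
    (hx : x ∈ U) : ∃ a, x ∈ basicOpen a ∧ basicOpen a ⊆ U := by
  obtain ⟨_, ⟨a, rfl⟩, h1, h2⟩ := (isTopologicalBasis_basicOpen R).exists_subset_of_mem_open hx hU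
  exact ⟨a, h1, h2⟩

theorem isClosed_basicOpen (a : R) : IsClosed (basicOpen a) := by
  refine isOpen_compl_iff.1 (isOpen_iff_mem_nhds.2 fun x hx => ?_)
  obtain ⟨b, hb⟩ := exists_mem_basicOpen x
  refine Filter.mem_of_superset ((isOpen_basicOpen (diff b a)).mem_nhds ?_) ?_
  · rw [basicOpen_diff]; exact ⟨hb, hx⟩
  · rw [basicOpen_diff]; exact fun y hy => hy.2

theorem isClopen_basicOpen (a : R) : IsClopen (basicOpen a) :=
  ⟨isClosed_basicOpen a, isOpen_basicOpen a⟩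

/-- An ultrafilter containing a basic open set converges to the point whose basic neighbourhoods are
the basic open sets in the ultrafilter. -/
theorem isCompact_basicOpen (a : R) : IsCompact (basicOpen a) := by
  refine isCompact_iff_ultrafilter_le_nhds.2 fun 𝒰 h𝒰 => ?_
  have ha : basicOpen a ∈ 𝒰 := Filter.le_principal_iff.1 h𝒰
  let p : R → Prop := fun b => basicOpen b ∈ 𝒰
  have hp : ∀ b, p b ↔ ∀ᶠ x in (𝒰 : Filter (StoneSpace R)), x ∈ basicOpen b := fun b => Iff.rfl
  have hmul : ∀ a b, p (a * b) ↔ p a ∧ p b := fun a b => by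
    simp only [hp, mem_basicOpen_mul, Filter.eventually_and]
  have hadd : ∀ a b, p (a + b) ↔ ¬(p a ↔ p b) := fun a b => by
    simp only [hp, mem_basicOpen_add]
    rw [Ultrafilter.eventually_not]
    simp only [iff_iff_implies_and_implies, Filter.eventually_and, Ultrafilter.eventually_imp]
  refine ⟨pointOfPred p hmul hadd ⟨a, ha⟩, (pointOfPred_mem hmul hadd _ a).2 ha, ?_⟩
  refine ((isTopologicalBasis_basicOpen R).nhds_hasBasis).ge_iff.2 ?_
  rintro _ ⟨⟨b, rfl⟩, hb⟩
  exact (pointOfPred_mem hmul hadd _ b).1 hb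

instance : T2Space (StoneSpace R) := by
  refine ⟨fun x y hxy => ?_⟩
  have : ∃ a, ¬(x ∈ basicOpen a ↔ y ∈ basicOpen a) := by
    by_contra! h
    exact hxy (stone_ext h)
  obtain ⟨a, ha⟩ := this
  by_cases hx : x ∈ basicOpen a
  · exact ⟨_, _, isOpen_basicOpen a, (isClosed_basicOpen a).isOpen_compl, hx,
      fun hy => ha (iff_of_true hx hy), disjoint_compl_right⟩
  · exact ⟨_, _, (isClosed_basicOpen a).isOpen_compl, isOpen_basicOpen a, hx,
      by by_contra hy; exact ha (iff_of_false hx hy), disjoint_compl_left⟩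

theorem exists_basicOpen_between {K U : Set (StoneSpace R)} (hK : IsCompact K) (hU : IsOpen U)
    (hKU : K ⊆ U) : ∃ a, K ⊆ basicOpen a ∧ basicOpen a ⊆ U := by
  refine hK.induction_on (p := fun s => ∃ a, s ⊆ basicOpen a ∧ basicOpen a ⊆ U) ?_ ?_ ?_ ?_
  · exact ⟨0, empty_subset _, fun x hx => (notMem_basicOpen_zero x hx).elim⟩
  · rintro s t hst ⟨a, h1, h2⟩
    exact ⟨a, hst.trans h1, h2⟩
  · rintro s t ⟨a, h1, h2⟩ ⟨b, h3, h4⟩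
    refine ⟨join a b, ?_, ?_⟩ <;> rw [basicOpen_join]
    exacts [union_subset_union h1 h3, union_subset h2 h4]
  · intro x hx
    obtain ⟨a, h1, h2⟩ := exists_basicOpen_subset hU (hKU hx)
    exact ⟨_, mem_nhdsWithin_of_mem_nhds ((isOpen_basicOpen a).mem_nhds h1), a, Subset.rfl, h2⟩

/-- The relatively compact sets are those contained in a basic open set. -/
theorem isCompact_closure_iff {A : Set (StoneSpace R)} :
    IsCompact (closure A) ↔ ∃ a, A ⊆ basicOpen a := by
  refine ⟨fun h => ?_, fun ⟨a, ha⟩ => ?_⟩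
  · obtain ⟨a, ha, -⟩ := exists_basicOpen_between h isOpen_univ (subset_univ _)
    exact ⟨a, subset_closure.trans ha⟩
  · exact (isCompact_basicOpen a).of_isClosed_subset isClosed_closure
      (closure_minimal ha (isClosed_basicOpen a))

theorem mem_derivedSet_iff {A : Set (StoneSpace R)} {x : StoneSpace R} :
    x ∈ derivedSet A ↔ ∀ a, x ∈ basicOpen a → ∃ y ∈ A, y ≠ x ∧ y ∈ basicOpen a := by
  rw [mem_derivedSet, accPt_iff_nhds]
  refine ⟨fun h a ha => ?_, fun h U hU => ?_⟩
  · obtain ⟨y, ⟨h1, h2⟩, h3⟩ := h _ ((isOpen_basicOpen a).mem_nhds ha)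
    exact ⟨y, h2, h3, h1⟩
  · obtain ⟨_, ⟨⟨a, rfl⟩, ha⟩, haU⟩ :=
      ((isTopologicalBasis_basicOpen R).nhds_hasBasis).mem_iff.1 hU
    obtain ⟨y, h1, h2, h3⟩ := h a ha
    exact ⟨y, ⟨haU h3, h1⟩, h2⟩

/-! ### The prime ideal theorem and its consequences -/

theorem add_self_of_mul_self (hR : ∀ a : R, a * a = a) (a : R) : a + a = 0 := by
  have h := hR (a + a)
  rw [mul_add, add_mul, hR] at h
  simpa using h

theorem mul_comm_of_mul_self (hR : ∀ a : R, a * a = a) (a b : R) : a * b = b * a := by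
  have h := hR (a + b)
  rw [mul_add, add_mul, add_mul, hR, hR] at h
  have h1 : a * b + b * a = 0 := by
    have h2 : a + b + (a * b + b * a) = a + b + 0 :=
      calc _ = a + b * a + (a * b + b) := by abel
        _ = a + b + 0 := by rw [h, add_zero]
    exact add_left_cancel h2
  calc a * b = a * b + (b * a + b * a) := by rw [add_self_of_mul_self hR, add_zero]
    _ = b * a := by rw [← add_assoc, h1, zero_add]

/-- Every nonzero element of a Boolean ring lies outside a prime ideal. -/
theorem basicOpen_nonempty (hR : ∀ a : R, a * a = a) {a : R} (ha : a ≠ 0) :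
    (basicOpen a).Nonempty := by
  let F : Set (Set R) := {I | 0 ∈ I ∧ (∀ x ∈ I, ∀ y ∈ I, x + y ∈ I) ∧
    (∀ x ∈ I, ∀ r, r * x ∈ I) ∧ a ∉ I}
  obtain ⟨I, -, hI⟩ := zorn_subset_nonempty F (by
    intro c hc hchain hne
    refine ⟨⋃₀ c, ⟨?_, ?_, ?_, ?_⟩, fun s hs => subset_sUnion_of_mem hs⟩
    · obtain ⟨s, hs⟩ := hne
      exact ⟨s, hs, (hc hs).1⟩
    · rintro x ⟨s, hs, hx⟩ y ⟨t, ht, hy⟩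
      rcases hchain.total hs ht with h | h
      · exact ⟨t, ht, (hc ht).2.1 x (h hx) y hy⟩
      · exact ⟨s, hs, (hc hs).2.1 x hx y (h hy)⟩
    · rintro x ⟨s, hs, hx⟩ r
      exact ⟨s, hs, (hc hs).2.2.1 x hx r⟩
    · rintro ⟨s, hs, hx⟩
      exact (hc hs).2.2.2 hx) {0} (by
    refine ⟨rfl, ?_, ?_, fun h => ha h⟩
    · rintro x hx y hy; rw [mem_singleton_iff] at *; simp [hx, hy]
    · rintro x hx r; rw [mem_singleton_iff] at *; simp [hx])
  obtain ⟨⟨h0, hadd, hmul, haI⟩, hmax⟩ := hI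
  have hcomm := mul_comm_of_mul_self hR
  have hself := add_self_of_mul_self hR
  -- enlarging `I` by an element outside it captures `a`
  have key : ∀ x ∉ I, ∃ i ∈ I, ∃ r, a = i + r * x := by
    intro x hx
    by_contra! hno
    have hsub : I ⊆ {z | ∃ i ∈ I, ∃ r, z = i + r * x} := fun i hi => ⟨i, hi, 0, by simp⟩
    have := hmax (y := {z | ∃ i ∈ I, ∃ r, z = i + r * x}) ⟨⟨0, h0, 0, by simp⟩, ?_, ?_, ?_⟩ hsub
    · exact hx (this ⟨0, h0, x, by simp [hR]⟩)
    · rintro _ ⟨i, hi, r, rfl⟩ _ ⟨j, hj, s, rfl⟩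
      exact ⟨i + j, hadd i hi j hj, r + s, by rw [add_mul]; abel⟩
    · rintro _ ⟨i, hi, r, rfl⟩ s
      exact ⟨s * i, hmul i hi s, s * r, by rw [mul_add, mul_assoc]⟩
    · rintro ⟨i, hi, r, h⟩
      exact hno i hi r h
  have hprime : ∀ x y, x * y ∈ I → x ∈ I ∨ y ∈ I := by
    intro x y hxy
    by_contra! hno
    obtain ⟨i, hi, r, h1⟩ := key x hno.1
    obtain ⟨j, hj, s, h2⟩ := key y hno.2
    refine haI ?_
    have h3 : a = a * j + ((s * y) * i + (r * s) * (x * y)) := by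
      have h4 : (r * x) * (s * y) = (r * s) * (x * y) := by
        rw [mul_assoc, ← mul_assoc x, hcomm x s, mul_assoc s, ← mul_assoc r]
      calc a = a * (j + s * y) := by rw [← h2, hR]
        _ = a * j + (i + r * x) * (s * y) := by rw [mul_add, ← h1]
        _ = _ := by rw [add_mul, hcomm i, h4]
    rw [h3]
    exact hadd _ (hmul j hj _) _ (hadd _ (hmul i hi _) _ (hmul _ hxy _))
  have hmulI : ∀ x y, x * y ∉ I ↔ x ∉ I ∧ y ∉ I := by
    intro x y
    rw [← not_or, not_iff_not]
    refine ⟨hprime x y, fun h => h.elim (fun h => ?_) fun h => hmul y h x⟩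
    rw [hcomm]; exact hmul x h y
  have haddI : ∀ x y, x + y ∉ I ↔ ¬(x ∉ I ↔ y ∉ I) := by
    intro x y
    rw [not_iff_not, not_iff_not]
    have hc : ∀ u v, u ∈ I → u + v ∈ I → v ∈ I := by
      intro u v hu huv
      have := hadd _ hu _ huv
      rwa [← add_assoc, hself, zero_add] at this
    refine ⟨fun h => ⟨fun hx => hc x y hx h, fun hy => hc y x hy (by rwa [add_comm])⟩, fun h => ?_⟩
    by_cases hx : x ∈ I
    · exact hadd _ hx _ (h.1 hx)
    · have hy : y ∉ I := fun hy => hx (h.2 hy)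
      have h1 : (x + y) * (x * y) ∈ I := by
        have : (x + y) * (x * y) = 0 := by
          rw [add_mul, ← mul_assoc, hR, hcomm x y, ← mul_assoc, hR, hself]
        rw [this]; exact h0
      exact (hprime _ _ h1).resolve_right ((hmulI x y).2 ⟨hx, hy⟩)
  exact ⟨pointOfPred (· ∉ I) hmulI haddI ⟨a, haI⟩, (pointOfPred_mem hmulI haddI _ a).2 haI⟩

theorem eq_of_basicOpen_eq (hR : ∀ a : R, a * a = a) {a b : R}
    (h : basicOpen a = basicOpen b) : a = b := by
  by_contra hab
  have : a + b ≠ 0 := by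
    intro h0
    refine hab ?_
    rw [← add_zero a, ← add_self_of_mul_self hR b, ← add_assoc, h0, zero_add]
  obtain ⟨x, hx⟩ := basicOpen_nonempty hR this
  rw [mem_basicOpen_add, h] at hx
  exact hx Iff.rfl

theorem mem_closedSet {J : TwoSidedIdeal R} {x : StoneSpace R} :
    x ∈ closedSet J ↔ ∀ a ∈ J, x ∉ basicOpen a := by
  simp [closedSet]

theorem isClosed_closedSet (J : TwoSidedIdeal R) : IsClosed (closedSet J) := by
  rw [closedSet, isClosed_compl_iff]
  exact isOpen_biUnion fun a _ => isOpen_basicOpen a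

/-- An ideal of a Boolean ring is determined by its closed set. -/
theorem mem_ideal_iff (hR : ∀ a : R, a * a = a) (J : TwoSidedIdeal R) (a : R) :
    a ∈ J ↔ Disjoint (basicOpen a) (closedSet J) := by
  refine ⟨fun ha => disjoint_left.2 fun x hx hJ => mem_closedSet.1 hJ a ha hx, fun h => ?_⟩
  have : ∃ b ∈ J, basicOpen a ⊆ basicOpen b := by
    refine (isCompact_basicOpen a).induction_on (p := fun s => ∃ b ∈ J, s ⊆ basicOpen b)
      ⟨0, J.zero_mem, empty_subset _⟩ (fun s t hst ⟨b, hb, hs⟩ => ⟨b, hb, hst.trans hs⟩) ?_ ?_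
    · rintro s t ⟨b, hb, hs⟩ ⟨c, hc, ht⟩
      refine ⟨join b c, J.add_mem (J.add_mem hb hc) (J.mul_mem_left _ _ hc), ?_⟩
      rw [basicOpen_join]
      exact union_subset_union hs ht
    · intro x hx
      have := disjoint_left.1 h hx
      rw [mem_closedSet] at this
      push Not at this
      obtain ⟨b, hb, hxb⟩ := this
      exact ⟨_, mem_nhdsWithin_of_mem_nhds ((isOpen_basicOpen b).mem_nhds hxb), b, hb, Subset.rfl⟩
  obtain ⟨b, hb, hab⟩ := this
  have : a = a * b := eq_of_basicOpen_eq hR (by rw [basicOpen_mul, inter_eq_left.2 hab])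
  rw [this]
  exact J.mul_mem_left _ _ hb

/-- The ideal of the elements whose basic open set misses a given set. -/
noncomputable def idealOf (C : Set (StoneSpace R)) : TwoSidedIdeal R :=
  TwoSidedIdeal.mk' {a | Disjoint (basicOpen a) C}
    (disjoint_left.2 fun x hx => (notMem_basicOpen_zero x hx).elim)
    (fun {a b} ha hb => disjoint_left.2 fun x hx hC => (mem_basicOpen_add x a b).1 hx
      (iff_of_false (fun h => disjoint_left.1 ha h hC) fun h => disjoint_left.1 hb h hC))
    (fun {a} ha => disjoint_left.2 fun x hx hC => disjoint_left.1 ha (by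
      rw [mem_basicOpen, map_neg] at hx
      rw [mem_basicOpen]
      revert hx
      generalize x.1 a = s
      revert s; decide) hC)
    (fun {a b} hb => disjoint_left.2 fun x hx hC =>
      disjoint_left.1 hb ((mem_basicOpen_mul x a b).1 hx).2 hC)
    (fun {a b} ha => disjoint_left.2 fun x hx hC =>
      disjoint_left.1 ha ((mem_basicOpen_mul x a b).1 hx).1 hC)

theorem mem_idealOf {C : Set (StoneSpace R)} {a : R} :
    a ∈ idealOf C ↔ Disjoint (basicOpen a) C := TwoSidedIdeal.mem_mk' _ _ _ _ _ _ _

theorem closedSet_idealOf {C : Set (StoneSpace R)} (hC : IsClosed C) :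
    closedSet (idealOf C) = C := by
  ext x
  rw [mem_closedSet]
  refine ⟨fun h => ?_, fun hx a ha hxa => disjoint_left.1 (mem_idealOf.1 ha) hxa hx⟩
  by_contra hx
  obtain ⟨a, h1, h2⟩ := exists_basicOpen_subset hC.isOpen_compl hx
  exact h a (mem_idealOf.2 (disjoint_left.2 fun y hy => h2 hy)) h1

end Stone
end BooleanIdeals

namespace BooleanIdeals

/-! ### Sequences built by stages -/

/-- The bookkeeping common to all back-and-forth constructions below: if every finite sequence that
is good in the sense of `G` can be prolonged to a good one in such a way as to perform any given task
`H i`, then there is an infinite sequence which performs the task `task k` at stage `k`. -/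
theorem exists_seq {A I : Type*} (G : ∀ k, (Fin k → A) → Prop)
    (H : I → ∀ k, (Fin k → A) → A → Prop) (task : ℕ → I) {k₀ : ℕ} (s₀ : Fin k₀ → A)
    (h₀ : G k₀ s₀)
    (step : ∀ k s, G k s → ∀ i, ∃ x, G (k + 1) (Fin.snoc (α := fun _ => A) s x) ∧ H i k s x) :
    ∃ a : ℕ → A, (∀ i : Fin k₀, a i = s₀ i) ∧ (∀ k ≥ k₀, G k fun i => a i) ∧
      ∀ k ≥ k₀, H (task k) k (fun i => a i) (a k) := by
  choose x hG hH using step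
  let st : ∀ m, {s : Fin (k₀ + m) → A // G _ s} := fun m => Nat.rec ⟨s₀, h₀⟩
    (fun m s => ⟨Fin.snoc (α := fun _ => A) s.1 (x _ s.1 s.2 (task (k₀ + m))), hG _ _ _ _⟩) m
  have hst : ∀ m, (st (m + 1)).1 =
    Fin.snoc (α := fun _ => A) (st m).1 (x _ (st m).1 (st m).2 (task (k₀ + m))) := fun _ => rfl
  let a : ℕ → A := fun n => (st (n + 1)).1 ⟨n, by omega⟩
  have hmono : ∀ m d i (h : i < k₀ + m), (st (m + d)).1 ⟨i, by omega⟩ = (st m).1 ⟨i, h⟩ := by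
    intro m d i h
    induction d with
    | zero => rfl
    | succ d ih =>
      rw [← ih]
      have := congrFun (hst (m + d)) ⟨i, by omega⟩
      refine this.trans ?_
      have h2 : (⟨i, by omega⟩ : Fin (k₀ + (m + d) + 1)) =
          Fin.castSucc ⟨i, by omega⟩ := rfl
      rw [h2, Fin.snoc_castSucc]
  have hcast : ∀ m m' (_ : m = m') i (h : i < k₀ + m) (h' : i < k₀ + m'),
      (st m).1 ⟨i, h⟩ = (st m').1 ⟨i, h'⟩ := by
    rintro m _ rfl i h h'; rfl
  have ha : ∀ m i (h : i < k₀ + m), a i = (st m).1 ⟨i, h⟩ := by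
    intro m i h
    rcases le_total m (i + 1) with h1 | h1
    · obtain ⟨d, hd⟩ := Nat.exists_eq_add_of_le h1
      have := hmono m d i h
      simp only [a]
      rw [← this]
      exact hcast _ _ hd i _ _
    · obtain ⟨d, rfl⟩ := Nat.exists_eq_add_of_le h1
      exact (hmono (i + 1) d i (by omega)).symm
  have ha' : ∀ m, (fun i : Fin (k₀ + m) => a i) = (st m).1 := fun m => by
    funext i; exact ha m i i.2
  refine ⟨a, fun i => ha 0 i i.2, fun k hk => ?_, fun k hk => ?_⟩
  · obtain ⟨m, rfl⟩ := Nat.exists_eq_add_of_le hk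
    rw [ha']; exact (st m).2
  · obtain ⟨m, rfl⟩ := Nat.exists_eq_add_of_le hk
    rw [ha', ha (m + 1) (k₀ + m) (by omega), hst]
    have h2 : (⟨k₀ + m, by omega⟩ : Fin (k₀ + m + 1)) = Fin.last _ := rfl
    rw [show (⟨k₀ + m, _⟩ : Fin (k₀ + (m + 1))) = (Fin.last (k₀ + m) : Fin (k₀ + m + 1)) from rfl]
    rw [Fin.snoc_last]
    exact hH _ _ _ _

/-! ### Structures with finitely many definable relations -/

open FirstOrder FirstOrder.Language

section ModelTheory

variable {L : FirstOrder.Language.{0, 0}} {M N : Type u} [L.Structure M] [L.Structure N]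

/-- The formula `∃ x, ψ(·, x)`. -/
noncomputable def exLast {k : ℕ} (ψ : L.Formula (Fin (k + 1))) : L.Formula (Fin k) :=
  Formula.iExs Unit (ψ.relabel (Fin.snoc (α := fun _ => Fin k ⊕ Unit) Sum.inl (Sum.inr ())))

theorem realize_exLast {k : ℕ} (ψ : L.Formula (Fin (k + 1))) (a : Fin k → M) :
    (exLast ψ).Realize a ↔ ∃ x, ψ.Realize (Fin.snoc (α := fun _ => M) a x) := by
  have key : ∀ i : Unit → M, (Sum.elim a i ∘
      (Fin.snoc (α := fun _ => Fin k ⊕ Unit) Sum.inl (Sum.inr ()))) =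
      Fin.snoc (α := fun _ => M) a (i ()) := by
    intro i
    funext j
    refine Fin.lastCases ?_ (fun j => ?_) j <;> simp
  simp only [exLast, Formula.realize_iExs, Formula.realize_relabel, key]
  exact ⟨fun ⟨i, h⟩ => ⟨i (), h⟩, fun ⟨x, h⟩ => ⟨fun _ => x, h⟩⟩

/-- The universal closure of `ψ`, as a formula with further (dummy) variables. -/
noncomputable def allClosure {α β : Type*} [Finite β] (ψ : L.Formula β) : L.Formula α :=
  Formula.iAlls β (ψ.relabel Sum.inr)

theorem realize_allClosure {α β : Type*} [Finite β] (ψ : L.Formula β) (a : α → M) :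
    (allClosure ψ).Realize a ↔ ∀ z : β → M, ψ.Realize z := by
  simp [allClosure, Formula.realize_iAlls, Formula.realize_relabel, Function.comp_def]

/-- Two tuples satisfy the same formulas. -/
def SameType {α : Type*} (a : α → M) (b : α → N) : Prop :=
  ∀ φ : L.Formula α, φ.Realize a ↔ φ.Realize b

variable (L M) in
/-- For each `k` there are only finitely many definable `k`-ary relations on `M`. -/
def FewDefinable : Prop :=
  ∀ k, (Set.range fun φ : L.Formula (Fin k) => {v : Fin k → M | φ.Realize v}).Finite

/-- A family of formulas closed under conjunction has a member implying all others, namely one that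
defines a minimal relation. -/
theorem FewDefinable.exists_isolating (h : FewDefinable L M) {k : ℕ} {F : Set (L.Formula (Fin k))}
    (hne : F.Nonempty) (hinf : ∀ φ ∈ F, ∀ ψ ∈ F, φ ⊓ ψ ∈ F) :
    ∃ ψ ∈ F, ∀ χ ∈ F, ∀ z : Fin k → M, ψ.Realize z → χ.Realize z := by
  let D : L.Formula (Fin k) → Set (Fin k → M) := fun φ => {v | φ.Realize v}
  have hfin : (D '' F).Finite := (h k).subset (Set.image_subset_range _ _)
  obtain ⟨m, ⟨⟨ψ, hψ, rfl⟩, hm⟩⟩ := hfin.exists_minimal (hne.image D)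
  refine ⟨ψ, hψ, fun χ hχ z hz => ?_⟩
  have := hm ⟨ψ ⊓ χ, hinf _ hψ _ hχ, rfl⟩ (fun z hz => (Formula.realize_inf.1 hz).1)
  exact (Formula.realize_inf.1 (this hz)).2

theorem SameType.symm {α : Type*} {a : α → M} {b : α → N} (h : SameType (L := L) a b) :
    SameType (L := L) b a := fun φ => (h φ).symm

/-- If `a` and `b` have the same type as some tuple of `M`, then every prolongation of `a` by a point
is matched by one of `b`. As `K₁` and `K₂` are arbitrary, this serves both directions of a
back-and-forth argument. -/
theorem FewDefinable.extend (h : FewDefinable L M) {K₁ K₂ : Type u} [L.Structure K₁]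
    [L.Structure K₂] {k : ℕ} {a : Fin k → K₁} {b : Fin k → K₂}
    (hab : SameType (L := L) a b) {e : Fin k → M} (he₂ : SameType (L := L) e b) (c : K₁) :
    ∃ d : K₂, SameType (L := L) (Fin.snoc (α := fun _ => K₁) a c)
      (Fin.snoc (α := fun _ => K₂) b d) := by
  obtain ⟨ψ, hψ, hiso⟩ := h.exists_isolating
    (F := {φ : L.Formula (Fin (k + 1)) | φ.Realize (Fin.snoc (α := fun _ => K₁) a c)})
    ⟨⊤, by simp⟩ (fun φ hφ ψ hψ => Formula.realize_inf.2 ⟨hφ, hψ⟩)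
  obtain ⟨d, hd⟩ := (realize_exLast ψ b).1 ((hab _).1 ((realize_exLast ψ a).2 ⟨c, hψ⟩))
  have key : ∀ χ : L.Formula (Fin (k + 1)), χ.Realize (Fin.snoc (α := fun _ => K₁) a c) →
      χ.Realize (Fin.snoc (α := fun _ => K₂) b d) := by
    intro χ hχ
    have h1 : (allClosure (ψ.imp χ) : L.Formula (Fin k)).Realize e :=
      (realize_allClosure _ _).2 fun z => Formula.realize_imp.2 (hiso χ hχ z)
    exact Formula.realize_imp.1 ((realize_allClosure _ _).1 ((he₂ _).1 h1) _) hd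
  refine ⟨d, fun χ => ⟨key χ, fun hd => ?_⟩⟩
  by_contra hc
  exact Formula.realize_not.1 (key χ.not (Formula.realize_not.2 hc)) hd

/-- A bijection that is assembled from tuples of the same type is an isomorphism. -/
theorem exists_equiv_of_seq (p : ℕ → M × N)
    (hp : ∀ K, ∃ k ≥ K, SameType (L := L) (fun i : Fin k => (p i).1) fun i : Fin k => (p i).2)
    (h₁ : ∀ x, ∃ i, (p i).1 = x) (h₂ : ∀ y, ∃ i, (p i).2 = y) :
    ∃ e : M ≃[L] N, ∀ i, e (p i).1 = (p i).2 := by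
  have key : ∀ {α : Type} [Finite α] (σ : α → ℕ),
      SameType (L := L) (fun i => (p (σ i)).1) fun i => (p (σ i)).2 := by
    intro α _ σ φ
    obtain ⟨K, hK⟩ := (Set.finite_range σ).bddAbove
    obtain ⟨k, hk, hs⟩ := hp (K + 1)
    have hlt : ∀ i, σ i < k := fun i => (Nat.lt_succ_of_le (hK ⟨i, rfl⟩)).trans_le hk
    have := hs (φ.relabel fun i => (⟨σ i, hlt i⟩ : Fin k))
    simpa only [Formula.realize_relabel, Function.comp_def] using this
  choose I hI using h₁
  have hwd : ∀ i j, (p i).1 = (p j).1 ↔ (p i).2 = (p j).2 := by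
    intro i j
    have := key (fun b : Bool => cond b i j) ((Term.var true).equal (Term.var false))
    simpa [Formula.realize_equal] using this
  let e : M → N := fun x => (p (I x)).2
  have he : ∀ i, e (p i).1 = (p i).2 := fun i => (hwd _ _).1 (hI _)
  have hbij : Function.Bijective e := by
    refine ⟨fun x y hxy => ?_, fun y => ?_⟩
    · have := (hwd (I x) (I y)).2 hxy
      rwa [hI, hI] at this
    · obtain ⟨i, rfl⟩ := h₂ y
      exact ⟨_, he i⟩
  have hreal : ∀ {α : Type} [Finite α] (φ : L.Formula α) (x : α → M),
      φ.Realize x ↔ φ.Realize (e ∘ x) := by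
    intro α _ φ x
    have := key (fun i => I (x i)) φ
    simp only [hI] at this
    exact this
  refine ⟨{ Equiv.ofBijective e hbij with map_fun' := ?_, map_rel' := ?_ }, he⟩
  · intro n f x
    have := hreal ((Term.func f fun i => Term.var (some i)).equal (Term.var none))
      (fun o : Option (Fin n) => o.elim (Structure.funMap f x) x)
    simp only [Formula.realize_equal, Term.realize_func, Term.realize_var, Option.elim,
      Function.comp_apply, true_iff] at this
    exact this.symm
  · intro n r x
    have := hreal (r.formula fun i => Term.var i) x
    simp only [Formula.realize_rel, Term.realize_var] at this
    exact this.symm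

/-- Tuples of the same type in countable structures correspond to each other under an isomorphism,
if one of the structures has finitely many definable relations of each arity. -/
theorem FewDefinable.exists_equiv [Countable M] [Countable N] [Nonempty M]
    (h : FewDefinable L M) {k : ℕ} {a : Fin k → M} {b : Fin k → N}
    (hab : SameType (L := L) a b) : ∃ e : M ≃[L] N, ∀ i, e (a i) = b i := by
  obtain ⟨t, ht⟩ := exists_surjective_nat (Option (M ⊕ N))
  -- each task recurs infinitely often, hence also after stage `k`
  let task : ℕ → Option (M ⊕ N) := fun n => t n.unpair.1
  have htask : ∀ o K, ∃ n ≥ K, task n = o := by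
    intro o K
    obtain ⟨m, rfl⟩ := ht o
    exact ⟨Nat.pair m K, Nat.right_le_pair _ _, by simp [task]⟩
  obtain ⟨p, hp0, hpG, hpH⟩ := exists_seq (A := M × N)
    (fun k s => SameType (L := L) (fun i => (s i).1) fun i => (s i).2)
    (fun o k s x => ∀ y, o = some y → Sum.elim (fun m => x.1 = m) (fun n => x.2 = n) y)
    task (fun i => (a i, b i)) hab (by
      intro k s hs o
      have hsnoc : ∀ x : M × N, SameType (L := L)
          (Fin.snoc (α := fun _ => M) (fun i => (s i).1) x.1)
          (Fin.snoc (α := fun _ => N) (fun i => (s i).2) x.2) →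
          SameType (L := L)
            (fun i => (Fin.snoc (α := fun _ => M × N) s x i).1)
            (fun i => (Fin.snoc (α := fun _ => M × N) s x i).2) := by
        intro x hx
        convert hx using 1
        · funext i
          refine Fin.lastCases ?_ (fun j => ?_) i <;> simp
        · funext i
          refine Fin.lastCases ?_ (fun j => ?_) i <;> simp
      match o with
      | some (Sum.inr y) =>
        obtain ⟨d, hd⟩ := h.extend hs.symm (fun φ => Iff.rfl) y
        exact ⟨(d, y), hsnoc _ hd.symm, by rintro _ ⟨⟩; rfl⟩
      | some (Sum.inl x) =>
        obtain ⟨d, hd⟩ := h.extend hs hs x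
        exact ⟨(x, d), hsnoc _ hd, by rintro _ ⟨⟩; rfl⟩
      | none =>
        obtain ⟨d, hd⟩ := h.extend hs hs (Classical.arbitrary M)
        exact ⟨(_, d), hsnoc _ hd, by rintro _ ⟨⟩⟩)
  obtain ⟨e, he⟩ := exists_equiv_of_seq (L := L) p
    (fun K => ⟨max K k, le_max_left _ _, hpG _ (le_max_right _ _)⟩)
    (fun x => by
      obtain ⟨n, hn, h⟩ := htask (some (Sum.inl x)) k
      exact ⟨n, hpH n hn _ h⟩)
    (fun y => by
      obtain ⟨n, hn, h⟩ := htask (some (Sum.inr y)) k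
      exact ⟨n, hpH n hn _ h⟩)
  refine ⟨e, fun i => ?_⟩
  have := he i
  rwa [hp0] at this

/-- The easy half of the Ryll-Nardzewski theorem: a countable structure is omega-categorical if its
automorphisms have finitely many orbits of `k`-tuples for each `k`. -/
theorem isOmegaCategorical_of_orbits [Countable M] [Nonempty M]
    (h : ∀ k, ∃ (T : Type v) (_ : Finite T) (τ : (Fin k → M) → T), ∀ a b, τ a = τ b →
      ∃ e : M ≃[L] M, ∀ i, e (a i) = b i) : IsOmegaCategorical L M := by
  intro N _ _ hMN
  have hfew : FewDefinable L M := by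
    intro k
    obtain ⟨T, _, τ, hτ⟩ := h k
    refine (Set.finite_range fun S : Set T => τ ⁻¹' S).subset ?_
    rintro _ ⟨φ, rfl⟩
    refine ⟨τ '' {v | φ.Realize v}, Set.Subset.antisymm ?_ (Set.subset_preimage_image _ _)⟩
    rintro b ⟨a, ha, hab⟩
    obtain ⟨e, he⟩ := hτ a b hab
    have : e ∘ a = b := funext he
    show φ.Realize b
    rw [← this]
    exact (StrongHomClass.realize_formula e φ).2 ha
  obtain ⟨e, -⟩ := hfew.exists_equiv (N := N) (k := 0) (a := Fin.elim0) (b := Fin.elim0) (by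
    intro φ
    have h1 : ∀ {K : Type u} [L.Structure K], φ.Realize (Fin.elim0 : Fin 0 → K) ↔
        K ⊨ (φ.relabel Fin.elim0 : L.Sentence) := by
      intro K _
      rw [Sentence.Realize, Formula.realize_relabel]
      exact iff_of_eq (congrArg _ (Subsingleton.elim _ _))
    rw [h1, h1]
    exact elementarilyEquivalent_iff.1 hMN _)
  exact ⟨e⟩

/-! ### Consequences of omega-categoricity -/

theorem exists_countable_elementarySubstructure [Countable (Σ l, L.Functions l)]
    [Countable (Σ l, L.Relations l)] {s : Set M} (hs : s.Countable) :
    ∃ S : L.ElementarySubstructure M, s ⊆ S ∧ Countable S := by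
  rcases le_total Cardinal.aleph0 (Cardinal.mk M) with h | h
  · have hL : L.card ≤ Cardinal.aleph0 := by
      rw [Language.card, Cardinal.mk_le_aleph0_iff]
      exact inferInstanceAs (Countable ((Σ l, L.Functions l) ⊕ (Σ l, L.Relations l)))
    obtain ⟨S, hS, hc⟩ := exists_elementarySubstructure_card_eq L s Cardinal.aleph0.{u} le_rfl
      (by simpa using hs.le_aleph0) (by simpa using hL) (by simpa using h)
    refine ⟨S, hS, ?_⟩
    rw [← Cardinal.mk_le_aleph0_iff]
    simpa using hc.le
  · refine ⟨⊤, fun _ _ => trivial, ?_⟩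
    have : Countable M := Cardinal.mk_le_aleph0_iff.1 h
    infer_instance

/-- Weak saturation: a countable structure which is the only countable model of its theory
realizes every type that is finitely satisfiable in it, because an ultrapower does. -/
theorem IsOmegaCategorical.exists_realize [Nonempty M] [Countable (Σ l, L.Functions l)]
    [Countable (Σ l, L.Relations l)] (hcat : IsOmegaCategorical L M) {k : ℕ}
    (φ : ℕ → L.Formula (Fin k)) (h : ∀ n, ∃ x : Fin k → M, ∀ m ≤ n, (φ m).Realize x) :
    ∃ x : Fin k → M, ∀ n, (φ n).Realize x := by
  choose x hx using h
  let U : Ultrafilter ℕ := Filter.hyperfilter ℕ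
  let K := (U : Filter ℕ).Product fun _ => M
  let y : Fin k → K := fun i => ((fun n => x n i : ℕ → M) : (U : Filter ℕ).Product fun _ => M)
  have hy : ∀ n, (φ n).Realize y := by
    intro n
    refine (Ultraproduct.realize_formula_cast (φ n) (fun i n => x n i)).2 ?_
    refine Filter.mem_of_superset
      (Filter.mem_hyperfilter_of_finite_compl (s := Set.Ici n) ?_) fun m hm => hx m n hm
    rw [Set.compl_Ici]
    exact Set.finite_Iio n
  have hKM : M ≅[L] K := by
    refine elementarilyEquivalent_iff.2 fun ψ => ?_
    rw [Ultraproduct.sentence_realize]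
    simp
  obtain ⟨S, hS, hSc⟩ := exists_countable_elementarySubstructure (L := L) (Set.countable_range y)
  obtain ⟨e⟩ := hcat S hSc (hKM.trans S.elementarilyEquivalent.symm)
  let z : Fin k → S := fun i => ⟨y i, hS ⟨i, rfl⟩⟩
  refine ⟨e.symm ∘ z, fun n => ?_⟩
  rw [StrongHomClass.realize_formula, ← S.subtype.map_formula]
  exact hy n

/-- The tuple `x` has an isolated type, isolated by `φ`. -/
def IsolatedBy {k : ℕ} (x : Fin k → M) (φ : L.Formula (Fin k)) : Prop :=
  φ.Realize x ∧ ∀ ψ : L.Formula (Fin k), ψ.Realize x → ∀ z : Fin k → M, φ.Realize z → ψ.Realize z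

theorem IsolatedBy.iff {k : ℕ} {x : Fin k → M} {φ : L.Formula (Fin k)} (h : IsolatedBy x φ)
    {z : Fin k → M} (hz : φ.Realize z) (ψ : L.Formula (Fin k)) : ψ.Realize z ↔ ψ.Realize x := by
  refine ⟨fun h1 => ?_, fun h1 => h.2 ψ h1 z hz⟩
  by_contra h2
  exact Formula.realize_not.1 (h.2 ψ.not (Formula.realize_not.2 h2) z hz) h1

theorem IsolatedBy.of_realize {k : ℕ} {x : Fin k → M} {φ : L.Formula (Fin k)}
    (h : IsolatedBy x φ) {z : Fin k → M} (hz : φ.Realize z) : IsolatedBy z φ :=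
  ⟨hz, fun ψ hψ w hw => h.2 ψ ((h.iff hz ψ).1 hψ) w hw⟩

/-- A subtuple of a tuple with isolated type has isolated type. -/
theorem IsolatedBy.comp {k m : ℕ} {x : Fin k → M} {θ : L.Formula (Fin k)} (h : IsolatedBy x θ)
    (σ : Fin m → Fin k) : ∃ η : L.Formula (Fin m), IsolatedBy (x ∘ σ) η := by
  let η : L.Formula (Fin m) := Formula.iExs (Fin k) (θ.relabel Sum.inr ⊓
    Formula.iInf fun i : Fin m => (Term.var (Sum.inl i)).equal (Term.var (Sum.inr (σ i))))
  have hη : ∀ w : Fin m → M, η.Realize w ↔ ∃ z : Fin k → M, θ.Realize z ∧ w = z ∘ σ := by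
    intro w
    simp only [η, Formula.realize_iExs, Formula.realize_inf, Formula.realize_relabel,
      Formula.realize_iInf, Formula.realize_equal, Term.realize_var, Sum.elim_inl, Sum.elim_inr,
      Sum.elim_comp_inr, funext_iff, Function.comp_apply]
  refine ⟨η, (hη _).2 ⟨x, h.1, rfl⟩, fun ψ hψ w hw => ?_⟩
  obtain ⟨z, hz, rfl⟩ := (hη w).1 hw
  rw [← Formula.realize_relabel] at hψ ⊢
  exact h.2 _ hψ z hz

variable [Countable M] [Nonempty M] [Countable (Σ l, L.Functions l)]
  [Countable (Σ l, L.Relations l)]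

/-- Isolated types are dense. Otherwise a consistent formula could be shrunk again and again so as
to miss one tuple of `M` after the other, against weak saturation. -/
theorem IsOmegaCategorical.exists_isolated (hcat : IsOmegaCategorical L M) {k : ℕ}
    (φ : L.Formula (Fin k)) {x : Fin k → M} (hx : φ.Realize x) :
    ∃ z : Fin k → M, φ.Realize z ∧ ∃ θ : L.Formula (Fin k), IsolatedBy z θ := by
  by_contra! hno
  obtain ⟨y, hy⟩ := exists_surjective_nat (Fin k → M)
  have step : ∀ (ψ : {ψ : L.Formula (Fin k) // (∃ w : Fin k → M, ψ.Realize w) ∧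
      ∀ w : Fin k → M, ψ.Realize w → φ.Realize w}) (z : Fin k → M),
      ∃ ψ' : {ψ : L.Formula (Fin k) // (∃ w : Fin k → M, ψ.Realize w) ∧
      ∀ w : Fin k → M, ψ.Realize w → φ.Realize w},
      (∀ w : Fin k → M, ψ'.1.Realize w → ψ.1.Realize w) ∧ ¬ ψ'.1.Realize z := by
    rintro ⟨ψ, ⟨w, hw⟩, hψ⟩ z
    by_cases hz : ψ.Realize z
    · have := hno z (hψ z hz) ψ
      simp only [IsolatedBy, hz, true_and, not_forall] at this
      obtain ⟨χ, hχ, w, hw, hw'⟩ := this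
      refine ⟨⟨ψ ⊓ χ.not, ⟨w, ?_⟩, fun w hw => hψ w (Formula.realize_inf.1 hw).1⟩,
        fun w hw => (Formula.realize_inf.1 hw).1, fun h => ?_⟩
      · exact Formula.realize_inf.2 ⟨hw, Formula.realize_not.2 hw'⟩
      · exact Formula.realize_not.1 (Formula.realize_inf.1 h).2 hχ
    · exact ⟨⟨ψ, ⟨w, hw⟩, hψ⟩, fun _ h => h, hz⟩
  choose next hnext hmiss using step
  let ψ : ℕ → {ψ : L.Formula (Fin k) // (∃ w : Fin k → M, ψ.Realize w) ∧
      ∀ w : Fin k → M, ψ.Realize w → φ.Realize w} := fun n =>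
    Nat.rec ⟨φ, ⟨x, hx⟩, fun _ h => h⟩ (fun n χ => next χ (y n)) n
  have hanti : ∀ n m, m ≤ n → ∀ w : Fin k → M, (ψ n).1.Realize w → (ψ m).1.Realize w := by
    intro n m hmn
    induction n, hmn using Nat.le_induction with
    | base => exact fun _ h => h
    | succ n _ ih => exact fun w hw => ih w (hnext (ψ n) (y n) w hw)
  obtain ⟨w, hw⟩ := hcat.exists_realize (fun n => (ψ n).1) fun n => by
    obtain ⟨w, hw⟩ := (ψ n).2.1
    exact ⟨w, fun m hm => hanti n m hm w hw⟩
  obtain ⟨n, rfl⟩ := hy w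
  exact hmiss (ψ n) (y n) (hw (n + 1))

/-- There is a sequence whose initial segments have isolated types and which contains witnesses
for all existential statements about its members. -/
theorem IsOmegaCategorical.exists_atomic_seq (hcat : IsOmegaCategorical L M) :
    ∃ a : ℕ → M, (∀ k, ∃ θ, IsolatedBy (L := L) (fun i : Fin k => a i) θ) ∧
      ∀ k (φ : L.Formula (Fin (k + 1))) (y : M),
        φ.Realize (Fin.snoc (α := fun _ => M) (fun i : Fin k => a i) y) →
        ∃ j, φ.Realize (Fin.snoc (α := fun _ => M) (fun i : Fin k => a i) (a j)) := by
  have : Nonempty (Σ k, L.Formula (Fin (k + 1))) := ⟨⟨0, ⊤⟩⟩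
  obtain ⟨t, ht⟩ := exists_surjective_nat (Σ k, L.Formula (Fin (k + 1)))
  obtain ⟨a, -, haG, haH⟩ := exists_seq (A := M) (fun k s => ∃ θ, IsolatedBy (L := L) s θ)
    (fun (o : Σ k, L.Formula (Fin (k + 1))) k s x => ∀ h : o.1 ≤ k,
      (∃ y, o.2.Realize (Fin.snoc (α := fun _ => M) (fun i => s (Fin.castLE h i)) y)) →
      o.2.Realize (Fin.snoc (α := fun _ => M) (fun i => s (Fin.castLE h i)) x))
    (fun n => t n.unpair.1) (k₀ := 0) Fin.elim0
    ⟨⊤, by simp, fun ψ hψ z _ => by rwa [Subsingleton.elim z Fin.elim0]⟩ (by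
      rintro k s ⟨θ, hθ⟩ ⟨j, φ⟩
      -- `χ` says that the new point is a witness, provided that there is one
      have : ∃ χ : L.Formula (Fin (k + 1)), (∃ y, χ.Realize (Fin.snoc (α := fun _ => M) s y)) ∧
          ∀ y, χ.Realize (Fin.snoc (α := fun _ => M) s y) → ∀ h : j ≤ k,
          (∃ y, φ.Realize (Fin.snoc (α := fun _ => M) (fun i => s (Fin.castLE h i)) y)) →
          φ.Realize (Fin.snoc (α := fun _ => M) (fun i => s (Fin.castLE h i)) y) := by
        by_cases hc : ∃ h : j ≤ k,
          ∃ y, φ.Realize (Fin.snoc (α := fun _ => M) (fun i => s (Fin.castLE h i)) y)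
        · obtain ⟨h, y, hy⟩ := hc
          have hcomp : ∀ y, (Fin.snoc (α := fun _ => M) s y) ∘ (Fin.snoc
              (α := fun _ => Fin (k + 1)) (fun i => (Fin.castLE h i).castSucc) (Fin.last k)) =
              Fin.snoc (α := fun _ => M) (fun i => s (Fin.castLE h i)) y := by
            intro y
            funext i
            refine Fin.lastCases ?_ (fun i => ?_) i <;>
              simp only [Function.comp_apply, Fin.snoc_castSucc, Fin.snoc_last]
          refine ⟨φ.relabel (Fin.snoc (α := fun _ => Fin (k + 1))
            (fun i => (Fin.castLE h i).castSucc) (Fin.last k)), ⟨y, ?_⟩, fun y hy _ _ => ?_⟩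
          · rwa [Formula.realize_relabel, hcomp]
          · rwa [Formula.realize_relabel, hcomp] at hy
        · exact ⟨⊤, ⟨Classical.arbitrary M, by simp⟩, fun _ _ h hy => (hc ⟨h, hy⟩).elim⟩
      obtain ⟨χ, ⟨y, hy⟩, hχ⟩ := this
      have hinit : ∀ w : Fin (k + 1) → M,
          (θ.relabel Fin.castSucc).Realize w ↔ θ.Realize (Fin.init w) := by
        intro w
        rw [Formula.realize_relabel]; rfl
      obtain ⟨w, hw, η, hη⟩ := hcat.exists_isolated (χ ⊓ θ.relabel Fin.castSucc)
        (x := Fin.snoc (α := fun _ => M) s y)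
        (Formula.realize_inf.2 ⟨hy, by rw [hinit, Fin.init_snoc]; exact hθ.1⟩)
      have h1 : (exLast η).Realize (Fin.init w) := by
        refine (realize_exLast _ _).2 ⟨w (Fin.last k), ?_⟩
        rw [Fin.snoc_init_self]; exact hη.1
      obtain ⟨x, hx⟩ := (realize_exLast η s).1
        ((hθ.iff ((hinit w).1 (Formula.realize_inf.1 hw).2) _).1 h1)
      exact ⟨x, ⟨η, hη.of_realize hx⟩, hχ x ((hη.iff hx _).2 (Formula.realize_inf.1 hw).1)⟩)
  refine ⟨a, fun k => haG k (Nat.zero_le _), fun k φ y hy => ?_⟩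
  obtain ⟨m, hm⟩ := ht ⟨k, φ⟩
  have := haH (Nat.pair m k) (Nat.zero_le _)
  have he : t (Nat.unpair (Nat.pair m k)).1 = ⟨k, φ⟩ := by rw [Nat.unpair_pair]; exact hm
  rw [he] at this
  exact ⟨Nat.pair m k, this (Nat.right_le_pair _ _) ⟨y, hy⟩⟩

/-- An omega-categorical structure is atomic: it is isomorphic to the elementary substructure
formed by an atomic sequence. -/
theorem IsOmegaCategorical.isolated (hcat : IsOmegaCategorical L M) {k : ℕ} (x : Fin k → M) :
    ∃ θ : L.Formula (Fin k), IsolatedBy x θ := by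
  obtain ⟨a, haG, haH⟩ := hcat.exists_atomic_seq
  have hbd : ∀ {m : ℕ} (σ : Fin m → ℕ), ∃ (K : ℕ) (ρ : Fin m → Fin K), ∀ i, (ρ i : ℕ) = σ i := by
    intro m σ
    obtain ⟨K, hK⟩ := (Set.finite_range σ).bddAbove
    exact ⟨K + 1, fun i => ⟨σ i, Nat.lt_succ_of_le (hK ⟨i, rfl⟩)⟩, fun i => rfl⟩
  have htv : ∀ {m : ℕ} (φ : L.Formula (Fin (m + 1))) (σ : Fin m → ℕ) (y : M),
      φ.Realize (Fin.snoc (α := fun _ => M) (fun i => a (σ i)) y) →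
      ∃ j, φ.Realize (Fin.snoc (α := fun _ => M) (fun i => a (σ i)) (a j)) := by
    intro m φ σ y hy
    obtain ⟨K, ρ, hρ⟩ := hbd σ
    have hcomp : ∀ y, (Fin.snoc (α := fun _ => M) (fun i : Fin K => a i) y) ∘ (Fin.snoc
        (α := fun _ => Fin (K + 1)) (fun i => (ρ i).castSucc) (Fin.last K)) =
        Fin.snoc (α := fun _ => M) (fun i => a (σ i)) y := by
      intro y
      funext i
      refine Fin.lastCases ?_ (fun i => ?_) i <;> simp [hρ]
    obtain ⟨j, hj⟩ := haH K (φ.relabel (Fin.snoc (α := fun _ => Fin (K + 1))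
      (fun i => (ρ i).castSucc) (Fin.last K))) y (by rwa [Formula.realize_relabel, hcomp])
    exact ⟨j, by rwa [Formula.realize_relabel, hcomp] at hj⟩
  let S : L.Substructure M :=
    { carrier := Set.range a
      fun_mem := by
        intro m f z hz
        choose σ hσ using hz
        obtain ⟨j, hj⟩ := htv ((Term.func f fun i => Term.var i.castSucc).equal
          (Term.var (Fin.last m))) σ (Structure.funMap f z) (by
            simp [Formula.realize_equal, hσ])
        refine ⟨j, ?_⟩
        simpa [Formula.realize_equal, hσ] using hj.symm }
  let E : L.ElementarySubstructure M := S.toElementarySubstructure (by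
    intro m φ z y hy
    choose σ hσ using fun i => (z i).2
    have hz : (fun i => a (σ i)) = ((↑) ∘ z : Fin m → M) := funext hσ
    have hφ : ∀ w : Fin (m + 1) → M, (φ.toFormula.relabel (Sum.elim Empty.elim id)).Realize w ↔
        φ.Realize default w := by
      intro w
      rw [Formula.realize_relabel, BoundedFormula.realize_toFormula]
      exact iff_of_eq (congrArg₂ _ (Subsingleton.elim _ _) rfl)
    obtain ⟨j, hj⟩ := htv (φ.toFormula.relabel (Sum.elim Empty.elim id)) σ y
      (by rw [hz]; exact (hφ _).2 hy)
    rw [hz] at hj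
    exact ⟨⟨a j, j, rfl⟩, (hφ _).1 hj⟩)
  have hE : Countable E := (Set.countable_range a).to_subtype
  obtain ⟨e⟩ := hcat E hE E.elementarilyEquivalent.symm
  choose σ hσ using fun i => (e (x i)).2
  obtain ⟨K, ρ, hρ⟩ := hbd σ
  obtain ⟨θ, hθ⟩ := haG K
  obtain ⟨η, hη⟩ := hθ.comp ρ
  have htr : ∀ (ψ : L.Formula (Fin k)) (z : Fin k → M),
      ψ.Realize z ↔ ψ.Realize (fun i => (e (z i) : M)) := by
    intro ψ z
    rw [← StrongHomClass.realize_formula e ψ, ← E.subtype.map_formula]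
    rfl
  have hx : (fun i : Fin K => a i) ∘ ρ = fun i => (e (x i) : M) := by
    funext i
    simp only [Function.comp_apply, hρ]
    exact hσ i
  rw [hx] at hη
  refine ⟨η, (htr _ _).2 hη.1, fun ψ hψ z hz => (htr _ _).2 (hη.2 ψ ((htr _ _).1 hψ) _
    ((htr _ _).1 hz))⟩

/-- The Ryll-Nardzewski theorem: an omega-categorical structure has finitely many definable
relations of each arity. -/
theorem IsOmegaCategorical.fewDefinable (hcat : IsOmegaCategorical L M) : FewDefinable L M := by
  intro k
  obtain ⟨y, hy⟩ := exists_surjective_nat (Fin k → M)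
  choose θ hθ using fun n => hcat.isolated (y n)
  -- by weak saturation, finitely many of the isolating formulas cover all tuples
  have : ∃ n, ∀ x : Fin k → M, ∃ m ≤ n, (θ m).Realize x := by
    by_contra! hno
    obtain ⟨x, hx⟩ := hcat.exists_realize (fun n => (θ n).not) fun n => by
      obtain ⟨x, hx⟩ := hno n
      exact ⟨x, fun m hm => Formula.realize_not.2 (hx m hm)⟩
    obtain ⟨n, rfl⟩ := hy x
    exact Formula.realize_not.1 (hx n) (hθ n).1
  obtain ⟨n, hn⟩ := this
  let τ : (Fin k → M) → Set (Fin (n + 1)) := fun x => {m | (θ m).Realize x}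
  refine (Set.finite_range fun S : Set (Set (Fin (n + 1))) => τ ⁻¹' S).subset ?_
  rintro _ ⟨φ, rfl⟩
  refine ⟨τ '' {v | φ.Realize v}, Set.Subset.antisymm ?_ (Set.subset_preimage_image _ _)⟩
  rintro b ⟨x, hx, hxb⟩
  obtain ⟨m, hm, hmx⟩ := hn x
  have hmem : (⟨m, Nat.lt_succ_of_le hm⟩ : Fin (n + 1)) ∈ τ b := hxb ▸ hmx
  exact ((hθ m).iff hmem φ).2 (((hθ m).iff hmx φ).1 hx)

/-- An omega-categorical structure has finitely many orbits of points under automorphisms. -/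
theorem IsOmegaCategorical.finite_orbits (hcat : IsOmegaCategorical L M) :
    ∃ (T : Type u) (_ : Finite T) (τ : M → T), ∀ a b, τ a = τ b → ∃ e : M ≃[L] M, e a = b := by
  have hfew := hcat.fewDefinable
  have : Finite (Set.range fun φ : L.Formula (Fin 1) => {v : Fin 1 → M | φ.Realize v}) :=
    (hfew 1).to_subtype
  refine ⟨Set (Set.range fun φ : L.Formula (Fin 1) => {v : Fin 1 → M | φ.Realize v}),
    inferInstance, fun a => {D | (fun _ => a) ∈ D.1}, fun a b hab => ?_⟩
  obtain ⟨e, he⟩ := hfew.exists_equiv (N := M) (k := 1) (a := fun _ => a) (b := fun _ => b)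
    (fun φ => by
      have := congrArg (fun S => (⟨_, φ, rfl⟩ : Set.range fun φ : L.Formula (Fin 1) =>
        {v : Fin 1 → M | φ.Realize v}) ∈ S) hab
      exact iff_of_eq this)
  exact ⟨e, he 0⟩

end ModelTheory
end BooleanIdeals

namespace BooleanIdeals
open Set TopologicalSpace StoneSpace

/-! ### Complete partitions -/

section Partition

variable {P : POSystem.{v}} {T : Type u} [TopologicalSpace T] {X : P.carrier → Set T}

theorem IsCompletePartition.exists_mem (hX : IsCompletePartition P X) (x : T) : ∃ p, x ∈ X p := by
  have := hX.cover ▸ mem_univ x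
  exact mem_iUnion.1 this

theorem IsCompletePartition.eq_of_mem (hX : IsCompletePartition P X) {x : T} {p q : P.carrier}
    (hp : x ∈ X p) (hq : x ∈ X q) : p = q := by
  by_contra h
  exact disjoint_left.1 (hX.disjoint h) hp hq

theorem IsCompletePartition.mem_derivedSet (hX : IsCompletePartition P X) {x : T}
    {p q : P.carrier} (hq : x ∈ X q) : x ∈ derivedSet (X p) ↔ P.lt q p := by
  rw [hX.derived p]
  simp only [mem_iUnion, mem_ofPred_eq, exists_prop]
  exact ⟨fun ⟨r, hr, hx⟩ => hX.eq_of_mem hq hx ▸ hr, fun h => ⟨q, h, hq⟩⟩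

/-- The trace on a closed set `U` of a union of parts is closed as soon as the labels form a set that
is lower among the labels of the parts meeting `U`. -/
theorem IsCompletePartition.isClosed_inter [Finite P.carrier] (hX : IsCompletePartition P X)
    {U : Set T} (hU : IsClosed U) {G : Set P.carrier}
    (hG : ∀ p ∈ G, ∀ q, P.lt q p → (U ∩ X q).Nonempty → q ∈ G) :
    IsClosed (U ∩ ⋃ p ∈ G, X p) := by
  refine isClosed_of_closure_subset fun x hx => ?_
  have hxU : x ∈ U := hU.closure_subset (closure_mono inter_subset_left hx)
  have hx2 : x ∈ closure (⋃ p ∈ G, X p) := closure_mono inter_subset_right hx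
  rw [(toFinite G).closure_biUnion] at hx2
  simp only [mem_iUnion, exists_prop] at hx2
  obtain ⟨p, hp, hxp⟩ := hx2
  rw [closure_eq_self_union_derivedSet] at hxp
  refine ⟨hxU, mem_iUnion₂.2 ?_⟩
  rcases hxp with h | h
  · exact ⟨p, hp, h⟩
  · obtain ⟨q, hq⟩ := hX.exists_mem x
    exact ⟨q, hG p hp q ((hX.mem_derivedSet hq).1 h) ⟨x, hxU, hq⟩, hq⟩

theorem IsCompletePartition.nontrivial_inter (hX : IsCompletePartition P X) {U : Set T}
    (hU : IsOpen U) {p : P.carrier} (hp : P.lt p p) (h : (U ∩ X p).Nonempty) :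
    (U ∩ X p).Nontrivial := by
  obtain ⟨x, hxU, hx⟩ := h
  obtain ⟨y, ⟨hyU, hy⟩, hyx⟩ :=
    accPt_iff_nhds.1 ((hX.mem_derivedSet hx).2 hp) U (hU.mem_nhds hxU)
  exact ⟨x, ⟨hxU, hx⟩, y, ⟨hyU, hy⟩, hyx.symm⟩

theorem IsCompletePartition.inter_nonempty_of_lt (hX : IsCompletePartition P X) {U : Set T}
    (hU : IsOpen U) {p q : P.carrier} (hqp : P.lt q p) (h : (U ∩ X q).Nonempty) :
    (U ∩ X p).Nonempty := by
  obtain ⟨x, hxU, hx⟩ := h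
  obtain ⟨y, hy, -⟩ := accPt_iff_nhds.1 ((hX.mem_derivedSet hx).2 hqp) U (hU.mem_nhds hxU)
  exact ⟨y, hy⟩

end Partition

/-! ### Splitting matched clopen sets -/

/-- The trace `S'` of a set on one part is to be split like a matched trace `S₁ ∪ S₂`. The set `A`
consists of points that have to go with `S₁` and `B` of points that have to go with `S₂`. If the part
is discrete (`D`), then `A` and `B` exhaust `S'` and have the right cardinalities; otherwise single
points suffice if both `S₁` and `S₂` are non-empty, as `S'` has two points. -/
theorem exists_split {α β : Type*} {S' : Set α} {S₁ S₂ : Set β} {D : Prop}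
    (hne : S'.Nonempty ↔ (S₁ ∪ S₂).Nonempty)
    (hD : D → S'.encard = S₁.encard + S₂.encard ∧ S'.Finite)
    (hC : ¬D → S'.Nonempty → S'.Nontrivial) :
    ∃ A B, A ⊆ S' ∧ B ⊆ S' ∧ Disjoint A B ∧ (A.Nonempty ↔ S₁.Nonempty) ∧
      (B.Nonempty ↔ S₂.Nonempty) ∧
      (D → A.encard = S₁.encard ∧ B.encard = S₂.encard ∧ A ∪ B = S') ∧
      (¬S₂.Nonempty → A = S') ∧ (¬S₁.Nonempty → B = S') ∧
      (S₁.Nonempty → S₂.Nonempty → A.Finite ∧ B.Finite) := by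
  by_cases h₂ : S₂.Nonempty
  · by_cases h₁ : S₁.Nonempty
    · have hS' : S'.Nonempty := hne.2 (h₁.mono subset_union_left)
      by_cases h : D
      · obtain ⟨hcard, hfin⟩ := hD h
        obtain ⟨A, hA, hAc⟩ := exists_subset_encard_eq (s := S') (k := S₁.encard)
          (by rw [hcard]; exact le_self_add)
        have hAfin := hfin.subset hA
        have hBc : (S' \ A).encard = S₂.encard := by
          have h3 := encard_sdiff_add_encard_of_subset hA
          rw [hcard, hAc, add_comm] at h3
          exact ENat.add_right_injective_of_ne_top
            (hAc ▸ encard_ne_top_iff.2 hAfin : S₁.encard ≠ ⊤) h3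
        refine ⟨A, S' \ A, hA, sdiff_subset, disjoint_sdiff_right, ?_, ?_,
          fun _ => ⟨hAc, hBc, union_sdiff_cancel hA⟩, fun h => (h h₂).elim, fun h => (h h₁).elim,
          fun _ _ => ⟨hAfin, hfin.subset sdiff_subset⟩⟩
        · rw [← encard_ne_zero, ← encard_ne_zero, hAc]
        · rw [← encard_ne_zero, ← encard_ne_zero, hBc]
      · obtain ⟨x, hx, y, hy, hxy⟩ := hC h hS'
        exact ⟨{x}, {y}, singleton_subset_iff.2 hx, singleton_subset_iff.2 hy,
          disjoint_singleton.2 hxy, by simp [h₁], by simp [h₂], fun hh => (h hh).elim,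
          fun h => (h h₂).elim, fun h => (h h₁).elim, fun _ _ => by simp⟩
    · have h1e := not_nonempty_iff_eq_empty.1 h₁
      subst h1e
      refine ⟨∅, S', empty_subset _, Subset.rfl, empty_disjoint _, by simp, by simpa using hne,
        fun h => ⟨by simp, by simpa using (hD h).1, by simp⟩, fun h => (h h₂).elim, fun _ => rfl,
        fun h => (h₁ h).elim⟩
  · have h2e := not_nonempty_iff_eq_empty.1 h₂
    subst h2e
    refine ⟨S', ∅, Subset.rfl, empty_subset _, disjoint_empty _, by simpa using hne, by simp,
      fun h => ⟨by simpa using (hD h).1, by simp, by simp⟩, fun _ => rfl, fun h => ?_,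
      fun _ h => (h₂ h).elim⟩
    have : ¬S'.Nonempty := fun h' => h (by simpa using hne.1 h')
    exact (not_nonempty_iff_eq_empty.1 this).symm

section Uniqueness

variable {R : Type u} [NonUnitalRing R] {R' : Type w} [NonUnitalRing R']
  {E : ExtPOSystem.{v}} {X : E.carrier → Set (StoneSpace R)} {X' : E.carrier → Set (StoneSpace R')}

theorem exists_basicOpen_eq {U : Set (StoneSpace R)} (hc : IsCompact U) (ho : IsOpen U) :
    ∃ a, basicOpen a = U := by
  obtain ⟨a, h1, h2⟩ := exists_basicOpen_between hc ho Subset.rfl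
  exact ⟨a, h2.antisymm h1⟩

variable (X X') in
/-- Two sets meet the parts of two partitions in the same way: in particular they meet the same
parts, and the traces on the finite parts have the same number of points. -/
structure Similar (U : Set (StoneSpace R)) (U' : Set (StoneSpace R')) : Prop where
  nonempty_iff : ∀ p, (U ∩ X p).Nonempty ↔ (U' ∩ X' p).Nonempty
  encard_eq : ∀ p ∈ E.discrete, (U ∩ X p).encard = (U' ∩ X' p).encard
  compact_iff : ∀ p, IsCompact (closure (U ∩ X p)) ↔ IsCompact (closure (U' ∩ X' p))

theorem Similar.symm {U : Set (StoneSpace R)} {U' : Set (StoneSpace R')} (h : Similar X X' U U') :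
    Similar X' X U' U :=
  ⟨fun p => (h.1 p).symm, fun p hp => (h.2 p hp).symm, fun p => (h.3 p).symm⟩

theorem similar_univ (hE : E.IsFiniteCrowded) (hX : IsCompleteExtPartition E X)
    (hX' : IsCompleteExtPartition E X') : Similar X X' univ univ := by
  refine ⟨fun p => ?_, fun p hp => ?_, fun p => ?_⟩ <;> simp only [univ_inter]
  · exact iff_of_true (hX.nonempty p) (hX'.nonempty p)
  · rw [hX.card_eq ⟨p, hE.2 hp, hp⟩, hX'.card_eq ⟨p, hE.2 hp, hp⟩]
  · rw [hX.compact_iff, hX'.compact_iff]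

/-- Removing a compact open set does not affect relative compactness. -/
theorem isCompact_closure_sdiff {U A : Set (StoneSpace R)} {c : R} :
    IsCompact (closure ((U \ basicOpen c) ∩ A)) ↔ IsCompact (closure (U ∩ A)) := by
  rw [isCompact_closure_iff, isCompact_closure_iff]
  refine ⟨fun ⟨a, ha⟩ => ⟨join a c, ?_⟩, fun ⟨a, ha⟩ => ⟨a, fun x hx => ha ⟨hx.1.1, hx.2⟩⟩⟩
  rw [basicOpen_join]
  intro x hx
  by_cases h : x ∈ basicOpen c
  · exact Or.inr h
  · exact Or.inl (ha ⟨⟨hx.1, h⟩, hx.2⟩)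

theorem isCompact_closure_of_subset {A : Set (StoneSpace R)} {c : R} (h : A ⊆ basicOpen c) :
    IsCompact (closure A) := isCompact_closure_iff.2 ⟨c, h⟩

/-- The key step of the back-and-forth argument: if `U` and `U'` are similar, then every
compact open subset of `U` is matched by one of `U'`. -/
theorem Similar.split (hE : E.IsFiniteCrowded) (hX : IsCompleteExtPartition E X)
    (hX' : IsCompleteExtPartition E X') {U : Set (StoneSpace R)} {U' : Set (StoneSpace R')}
    (hU : IsClopen U) (hU' : IsClopen U') (h : Similar X X' U U') {c : R} (hc : basicOpen c ⊆ U) :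
    ∃ c' : R', basicOpen c' ⊆ U' ∧ Similar X X' (basicOpen c) (basicOpen c') ∧
      Similar X X' (U \ basicOpen c) (U' \ basicOpen c') := by
  have := hE.1
  have hun : ∀ p, (basicOpen c ∩ X p) ∪ ((U \ basicOpen c) ∩ X p) = U ∩ X p := fun p => by
    rw [← union_inter_distrib_right, union_sdiff_cancel hc]
  have hdj : ∀ p, Disjoint (basicOpen c ∩ X p) ((U \ basicOpen c) ∩ X p) := fun p =>
    (disjoint_sdiff_right).mono inter_subset_left inter_subset_left
  have hsplit : ∀ p, _ := fun p => exists_split (S' := U' ∩ X' p) (S₁ := basicOpen c ∩ X p)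
    (S₂ := (U \ basicOpen c) ∩ X p) (D := p ∈ E.discrete)
    (by rw [hun, h.nonempty_iff])
    (fun hp => ⟨by rw [← encard_union_eq (hdj p), hun, h.encard_eq p hp], by
      refine Finite.subset ?_ (inter_subset_right)
      rw [← encard_ne_top_iff, hX'.card_eq ⟨p, hE.2 hp, hp⟩]
      exact ENat.natCast_ne_top _⟩)
    (fun hp => hX'.nontrivial_inter hU'.2 (not_not.1 hp))
  choose A B hA hB hAB hA₁ hB₂ hD hA' hB' hfin using hsplit
  -- `A p` is the trace on `X' p` which `c'` is to contain, `B p` the one which it is to avoid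
  -- `⋃ p, Z p` is closed both for `Z = A` and for `Z = B`: the parts which meet `W` contribute a
  -- finite set, and the labels of the others form a lower set
  have hclosed : ∀ (V W : Set (StoneSpace R)) (Z : E.carrier → Set (StoneSpace R')),
      IsOpen W → (∀ p, (U ∩ X p).Nonempty ↔ (V ∩ X p).Nonempty ∨ (W ∩ X p).Nonempty) →
      (∀ p, (Z p).Nonempty ↔ (V ∩ X p).Nonempty) →
      (∀ p, ¬(W ∩ X p).Nonempty → Z p = U' ∩ X' p) →
      (∀ p, (V ∩ X p).Nonempty → (W ∩ X p).Nonempty → (Z p).Finite) →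
      IsClosed (⋃ p, Z p) := by
    intro V W Z hW hVW hZ₁ hZ₂ hZ₃
    have hG : IsClosed (U' ∩ ⋃ p ∈ {p | ¬(W ∩ X p).Nonempty}, X' p) := by
      refine hX'.isClosed_inter hU'.1 fun p hp q hqp _ hq => hp ?_
      exact hX.inter_nonempty_of_lt hW hqp hq
    have hF : (⋃ p ∈ {p | (W ∩ X p).Nonempty}, Z p).Finite := by
      refine (toFinite _).biUnion fun p hp => ?_
      by_cases hp2 : (V ∩ X p).Nonempty
      · exact hZ₃ p hp2 hp
      · rw [not_nonempty_iff_eq_empty.1 (mt (hZ₁ p).1 hp2)]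
        exact finite_empty
    have : ⋃ p, Z p = (U' ∩ ⋃ p ∈ {p | ¬(W ∩ X p).Nonempty}, X' p) ∪
        ⋃ p ∈ {p | (W ∩ X p).Nonempty}, Z p := by
      ext x
      simp only [mem_iUnion, mem_union, mem_inter_iff, mem_ofPred_eq, exists_prop]
      constructor
      · rintro ⟨p, hp⟩
        by_cases hp2 : (W ∩ X p).Nonempty
        · exact Or.inr ⟨p, hp2, hp⟩
        · have := hZ₂ p hp2 ▸ hp
          exact Or.inl ⟨this.1, p, hp2, this.2⟩
      · rintro (⟨hx, p, hp, hxp⟩ | ⟨p, -, hp⟩)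
        · exact ⟨p, by rw [hZ₂ p hp]; exact ⟨hx, hxp⟩⟩
        · exact ⟨p, hp⟩
    rw [this]
    exact hG.union hF.isClosed
  have hne : ∀ p, (U ∩ X p).Nonempty ↔
      (basicOpen c ∩ X p).Nonempty ∨ ((U \ basicOpen c) ∩ X p).Nonempty := fun p => by
    rw [← hun, union_nonempty]
  have hAcl : IsClosed (⋃ p, A p) := hclosed _ _ A (hU.2.sdiff (isClosed_basicOpen c)) hne hA₁ hA'
    fun p h1 h2 => (hfin p h1 h2).1
  have hBcl : IsClosed (⋃ p, B p) := hclosed _ _ B (isOpen_basicOpen c)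
    (fun p => (hne p).trans or_comm) hB₂ hB' fun p h1 h2 => (hfin p h2 h1).2
  have hAcpt : IsCompact (⋃ p, A p) := by
    refine (isCompact_iUnion (f := fun p => closure (A p)) fun p => ?_).of_isClosed_subset hAcl
      (iUnion_mono fun p => subset_closure)
    by_cases h2 : ((U \ basicOpen c) ∩ X p).Nonempty
    · by_cases h1 : (basicOpen c ∩ X p).Nonempty
      · rw [(hfin p h1 h2).1.isClosed.closure_eq]
        exact (hfin p h1 h2).1.isCompact
      · rw [not_nonempty_iff_eq_empty.1 (mt (hA₁ p).1 h1)]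
        simp
    · rw [hA' p h2, ← h.compact_iff, ← hun, not_nonempty_iff_eq_empty.1 h2, union_empty]
      exact isCompact_closure_of_subset inter_subset_left
  obtain ⟨c', hc1, hc2⟩ := exists_basicOpen_between hAcpt
    (hU'.2.sdiff hBcl) (fun x hx => ⟨by
      obtain ⟨p, hp⟩ := mem_iUnion.1 hx
      exact (hA p hp).1, fun hx2 => by
      obtain ⟨p, hp⟩ := mem_iUnion.1 hx
      obtain ⟨q, hq⟩ := mem_iUnion.1 hx2
      obtain rfl := hX'.eq_of_mem (hA p hp).2 (hB q hq).2
      exact disjoint_left.1 (hAB p) hp hq⟩)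
  have hAc : ∀ p, A p ⊆ basicOpen c' ∩ X' p := fun p x hx =>
    ⟨hc1 (mem_iUnion.2 ⟨p, hx⟩), (hA p hx).2⟩
  have hBc : ∀ p, B p ⊆ (U' \ basicOpen c') ∩ X' p := fun p x hx =>
    ⟨⟨(hB p hx).1, fun hxc => (hc2 hxc).2 (mem_iUnion.2 ⟨p, hx⟩)⟩, (hB p hx).2⟩
  have hcU : basicOpen c' ⊆ U' := fun x hx => (hc2 hx).1
  refine ⟨c', hcU, ⟨fun p => ?_, fun p hp => ?_, fun p => ?_⟩, ⟨fun p => ?_, fun p hp => ?_,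
    fun p => ?_⟩⟩
  · refine ⟨fun h1 => ((hA₁ p).2 h1).mono (hAc p), fun ⟨x, hx⟩ => ?_⟩
    by_contra h1
    have : x ∈ B p := by rw [hB' p h1]; exact ⟨hcU hx.1, hx.2⟩
    exact (hBc p this).1.2 hx.1
  · rw [← (hD p hp).1]
    congr 1
    refine (hAc p).antisymm fun x hx => ?_
    have : x ∈ A p ∪ B p := by rw [(hD p hp).2.2]; exact ⟨hcU hx.1, hx.2⟩
    exact this.resolve_right fun hx2 => (hBc p hx2).1.2 hx.1
  · exact iff_of_true (isCompact_closure_of_subset inter_subset_left)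
      (isCompact_closure_of_subset inter_subset_left)
  · refine ⟨fun h1 => ((hB₂ p).2 h1).mono (hBc p), fun ⟨x, hx⟩ => ?_⟩
    by_contra h1
    have : x ∈ A p := by rw [hA' p h1]; exact ⟨hx.1.1, hx.2⟩
    exact hx.1.2 (hAc p this).1
  · rw [← (hD p hp).2.1]
    congr 1
    refine (hBc p).antisymm fun x hx => ?_
    have : x ∈ A p ∪ B p := by rw [(hD p hp).2.2]; exact ⟨hx.1.1, hx.2⟩
    exact this.resolve_left fun hx2 => hx.1.2 (hAc p hx2).1
  · rw [isCompact_closure_sdiff, isCompact_closure_sdiff, h.compact_iff]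

/-! ### Back and forth -/

/-- The set of points whose membership in the sets `a i` is prescribed by `ε`. -/
def cell {k : ℕ} (a : Fin k → R) (ε : Fin k → Prop) : Set (StoneSpace R) :=
  {x | ∀ i, x ∈ basicOpen (a i) ↔ ε i}

theorem isClopen_cell {k : ℕ} (a : Fin k → R) (ε : Fin k → Prop) : IsClopen (cell a ε) := by
  have : cell a ε = ⋂ i, {x | x ∈ basicOpen (a i) ↔ ε i} := by
    ext x; simp [cell]
  rw [this]
  refine isClopen_iInter_of_finite fun i => ?_
  by_cases h : ε i
  · simpa [h] using isClopen_basicOpen (a i)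
  · simp only [h, iff_false]
    exact (isClopen_basicOpen (a i)).compl

variable (X X') in
/-- Two tuples of ring elements cut the two Stone spaces into pairwise similar cells. -/
def SimilarTuple {k : ℕ} (a : Fin k → R) (b : Fin k → R') : Prop :=
  ∀ ε, Similar X X' (cell a ε) (cell b ε)

theorem SimilarTuple.symm {k : ℕ} {a : Fin k → R} {b : Fin k → R'}
    (h : SimilarTuple X X' a b) : SimilarTuple X' X b a := fun ε => (h ε).symm

theorem cell_snoc {k : ℕ} (a : Fin k → R) (c : R) (ε : Fin (k + 1) → Prop) :
    cell (Fin.snoc (α := fun _ => R) a c) ε =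
      {x | x ∈ cell a (fun i => ε i.castSucc) ∧ (x ∈ basicOpen c ↔ ε (Fin.last k))} := by
  ext x
  simp only [cell, mem_ofPred_eq]
  rw [Fin.forall_fin_succ']
  simp only [Fin.snoc_castSucc, Fin.snoc_last]

/-- Similar tuples can be prolonged: the new element is split along the cells of the first tuple,
and the pieces are matched separately. -/
theorem SimilarTuple.extend (hE : E.IsFiniteCrowded) (hX : IsCompleteExtPartition E X)
    (hX' : IsCompleteExtPartition E X') {k : ℕ} {a : Fin k → R} {b : Fin k → R'}
    (h : SimilarTuple X X' a b) (c : R) :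
    ∃ d, SimilarTuple X X' (Fin.snoc (α := fun _ => R) a c) (Fin.snoc (α := fun _ => R') b d) := by
  have h1 : ∀ ε, ∃ cε, basicOpen cε = basicOpen c ∩ cell a ε := fun ε =>
    exists_basicOpen_eq ((isCompact_basicOpen c).inter_right (isClopen_cell a ε).1)
      ((isOpen_basicOpen c).inter (isClopen_cell a ε).2)
  choose cε hcε using h1
  choose dε hd1 hd2 hd3 using fun ε => (h ε).split hE hX hX' (isClopen_cell a ε)
    (isClopen_cell b ε) (c := cε ε) (by rw [hcε]; exact inter_subset_right)
  obtain ⟨d, hd⟩ := exists_basicOpen_eq (U := ⋃ ε, basicOpen (dε ε))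
    (isCompact_iUnion fun ε => isCompact_basicOpen _) (isOpen_iUnion fun ε => isOpen_basicOpen _)
  have hdε : ∀ ε, ∀ x ∈ cell b ε, x ∈ basicOpen d ↔ x ∈ basicOpen (dε ε) := by
    intro ε x hx
    rw [hd, mem_iUnion]
    refine ⟨fun ⟨ε', h'⟩ => ?_, fun h' => ⟨ε, h'⟩⟩
    have : ε' = ε := funext fun i => propext ((hd1 ε' h' i).symm.trans (hx i))
    rwa [this] at h'
  have hcε' : ∀ ε, ∀ x ∈ cell a ε, x ∈ basicOpen c ↔ x ∈ basicOpen (cε ε) := by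
    intro ε x hx
    rw [hcε]
    exact ⟨fun h => ⟨h, hx⟩, fun h => h.1⟩
  refine ⟨d, fun ε => ?_⟩
  rw [cell_snoc, cell_snoc]
  set η : Fin k → Prop := fun i => ε i.castSucc
  by_cases hl : ε (Fin.last k)
  · convert hd2 η using 1
    · ext x
      simp only [mem_ofPred_eq, hl, iff_true]
      refine ⟨fun hx => (hcε' η x hx.1).1 hx.2, fun hx => ?_⟩
      rw [hcε] at hx
      exact ⟨hx.2, hx.1⟩
    · ext x
      simp only [mem_ofPred_eq, hl, iff_true]
      exact ⟨fun hx => (hdε η x hx.1).1 hx.2, fun hx => ⟨hd1 η hx, (hdε η x (hd1 η hx)).2 hx⟩⟩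
  · convert hd3 η using 1
    · ext x
      simp only [mem_ofPred_eq, hl, iff_false, mem_sdiff]
      exact and_congr_right fun hx => not_congr (hcε' η x hx)
    · ext x
      simp only [mem_ofPred_eq, hl, iff_false, mem_sdiff]
      exact and_congr_right fun hx => not_congr (hdε η x hx)

/-- A bijection that is assembled from similar tuples is an isomorphism respecting the parts. -/
theorem exists_ringEquiv_of_seq (hR : ∀ a : R, a * a = a) (hR' : ∀ a : R', a * a = a)
    (hX : IsCompleteExtPartition E X) (hX' : IsCompleteExtPartition E X') (p : ℕ → R × R')
    (hp : ∀ K, ∃ k ≥ K, SimilarTuple X X' (fun i : Fin k => (p i).1) fun i : Fin k => (p i).2)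
    (h₁ : ∀ x, ∃ i, (p i).1 = x) (h₂ : ∀ y, ∃ i, (p i).2 = y) :
    ∃ e : R ≃+* R', (∀ i, e (p i).1 = (p i).2) ∧
      ∀ r q, (basicOpen r ∩ X q).Nonempty ↔ (basicOpen (e r) ∩ X' q).Nonempty := by
  have fwd : ∀ K q, ∀ x ∈ X q, ∃ y ∈ X' q,
      ∀ i < K, x ∈ basicOpen (p i).1 ↔ y ∈ basicOpen (p i).2 := by
    intro K q x hx
    obtain ⟨k, hk, hs⟩ := hp K
    obtain ⟨y, hy, hyq⟩ := ((hs fun i => x ∈ basicOpen (p i).1).nonempty_iff q).1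
      ⟨x, fun i => Iff.rfl, hx⟩
    exact ⟨y, hyq, fun i hi => (hy ⟨i, hi.trans_le hk⟩).symm⟩
  have bwd : ∀ K q, ∀ y ∈ X' q, ∃ x ∈ X q,
      ∀ i < K, x ∈ basicOpen (p i).1 ↔ y ∈ basicOpen (p i).2 := by
    intro K q y hy
    obtain ⟨k, hk, hs⟩ := hp K
    obtain ⟨x, hx, hxq⟩ := ((hs fun i => y ∈ basicOpen (p i).2).nonempty_iff q).2
      ⟨y, fun i => Iff.rfl, hy⟩
    exact ⟨x, hxq, fun i hi => hx ⟨i, hi.trans_le hk⟩⟩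
  have bwd' : ∀ K y, ∃ x : StoneSpace R,
      ∀ i < K, x ∈ basicOpen (p i).1 ↔ y ∈ basicOpen (p i).2 := by
    intro K y
    obtain ⟨q, hq⟩ := hX'.exists_mem y
    obtain ⟨x, -, h⟩ := bwd K q y hq
    exact ⟨x, h⟩
  choose I hI using h₁
  let e : R → R' := fun x => (p (I x)).2
  have key : ∀ i j, (p i).1 = (p j).1 → (p i).2 = (p j).2 := by
    intro i j hij
    refine eq_of_basicOpen_eq hR' (Set.ext fun y => ?_)
    obtain ⟨x, hx⟩ := bwd' (max i j + 1) y
    rw [← hx i (by omega), ← hx j (by omega), hij]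
  have key' : ∀ i j, (p i).2 = (p j).2 → (p i).1 = (p j).1 := by
    intro i j hij
    refine eq_of_basicOpen_eq hR (Set.ext fun x => ?_)
    obtain ⟨q, hq⟩ := hX.exists_mem x
    obtain ⟨y, -, hy⟩ := fwd (max i j + 1) q x hq
    rw [hy i (by omega), hy j (by omega), hij]
  have he : ∀ i, e (p i).1 = (p i).2 := fun i => key _ _ (hI _)
  have hmem : ∀ r s t y, ∃ x : StoneSpace R, (x ∈ basicOpen r ↔ y ∈ basicOpen (e r)) ∧
      (x ∈ basicOpen s ↔ y ∈ basicOpen (e s)) ∧ (x ∈ basicOpen t ↔ y ∈ basicOpen (e t)) := by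
    intro r s t y
    obtain ⟨x, hx⟩ := bwd' (max (I r) (max (I s) (I t)) + 1) y
    refine ⟨x, ?_, ?_, ?_⟩
    · rw [← hx (I r) (by omega), hI]
    · rw [← hx (I s) (by omega), hI]
    · rw [← hx (I t) (by omega), hI]
  have hbij : Function.Bijective e := by
    refine ⟨fun x y hxy => ?_, fun y => ?_⟩
    · have := key' (I x) (I y) hxy
      rwa [hI, hI] at this
    · obtain ⟨i, rfl⟩ := h₂ y
      exact ⟨_, he i⟩
  refine ⟨{ Equiv.ofBijective e hbij with map_mul' := ?_, map_add' := ?_ }, he, ?_⟩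
  · intro r s
    refine eq_of_basicOpen_eq hR' (Set.ext fun y => ?_)
    obtain ⟨x, h1, h2, h3⟩ := hmem r s (r * s) y
    rw [mem_basicOpen_mul]
    exact h3.symm.trans ((mem_basicOpen_mul x r s).trans (and_congr h1 h2))
  · intro r s
    refine eq_of_basicOpen_eq hR' (Set.ext fun y => ?_)
    obtain ⟨x, h1, h2, h3⟩ := hmem r s (r + s) y
    rw [mem_basicOpen_add]
    exact h3.symm.trans ((mem_basicOpen_add x r s).trans (not_congr (iff_congr h1 h2)))
  · intro r q
    constructor
    · rintro ⟨x, hx, hxq⟩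
      obtain ⟨y, hyq, hy⟩ := fwd (I r + 1) q x hxq
      exact ⟨y, (hy (I r) (by omega)).1 (by rwa [hI]), hyq⟩
    · rintro ⟨y, hy, hyq⟩
      obtain ⟨x, hxq, hx⟩ := bwd (I r + 1) q y hyq
      have := (hx (I r) (by omega)).2 hy
      rw [hI] at this
      exact ⟨x, this, hxq⟩

/-- Countable Boolean rings whose Stone spaces have complete partitions of the same finite-crowded
kind are isomorphic, by an isomorphism that respects the parts and extends a given matching of
similar tuples. -/
theorem SimilarTuple.exists_ringEquiv [Countable R] [Countable R'] (hR : ∀ a : R, a * a = a)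
    (hR' : ∀ a : R', a * a = a) (hE : E.IsFiniteCrowded) (hX : IsCompleteExtPartition E X)
    (hX' : IsCompleteExtPartition E X') {k : ℕ} {a : Fin k → R} {b : Fin k → R'}
    (hab : SimilarTuple X X' a b) :
    ∃ e : R ≃+* R', (∀ i, e (a i) = b i) ∧
      ∀ r q, (basicOpen r ∩ X q).Nonempty ↔ (basicOpen (e r) ∩ X' q).Nonempty := by
  have : Nonempty (R ⊕ R') := ⟨Sum.inl 0⟩
  obtain ⟨t, ht⟩ := exists_surjective_nat (R ⊕ R')
  let task : ℕ → R ⊕ R' := fun n => t n.unpair.1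
  have htask : ∀ o K, ∃ n ≥ K, task n = o := by
    intro o K
    obtain ⟨m, rfl⟩ := ht o
    exact ⟨Nat.pair m K, Nat.right_le_pair _ _, by simp [task]⟩
  obtain ⟨p, hp0, hpG, hpH⟩ := exists_seq (A := R × R')
    (fun k s => SimilarTuple X X' (fun i => (s i).1) fun i => (s i).2)
    (fun o k s x => Sum.elim (fun m => x.1 = m) (fun n => x.2 = n) o)
    task (fun i => (a i, b i)) hab (by
      intro k s hs o
      have hsnoc : ∀ x : R × R', SimilarTuple X X'
          (Fin.snoc (α := fun _ => R) (fun i => (s i).1) x.1)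
          (Fin.snoc (α := fun _ => R') (fun i => (s i).2) x.2) →
          SimilarTuple X X'
            (fun i => (Fin.snoc (α := fun _ => R × R') s x i).1)
            (fun i => (Fin.snoc (α := fun _ => R × R') s x i).2) := by
        intro x hx
        convert hx using 1
        · funext i
          refine Fin.lastCases ?_ (fun j => ?_) i <;> simp
        · funext i
          refine Fin.lastCases ?_ (fun j => ?_) i <;> simp
      match o with
      | Sum.inr y =>
        obtain ⟨d, hd⟩ := hs.symm.extend hE hX' hX y
        exact ⟨(d, y), hsnoc _ hd.symm, rfl⟩
      | Sum.inl x =>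
        obtain ⟨d, hd⟩ := hs.extend hE hX hX' x
        exact ⟨(x, d), hsnoc _ hd, rfl⟩)
  obtain ⟨e, he, hq⟩ := exists_ringEquiv_of_seq hR hR' hX hX' p
    (fun K => ⟨max K k, le_max_left _ _, hpG _ (le_max_right _ _)⟩)
    (fun x => by
      obtain ⟨n, hn, h⟩ := htask (Sum.inl x) k
      have := hpH n hn
      rw [h] at this
      exact ⟨n, this⟩)
    (fun y => by
      obtain ⟨n, hn, h⟩ := htask (Sum.inr y) k
      have := hpH n hn
      rw [h] at this
      exact ⟨n, this⟩)
  refine ⟨e, fun i => ?_, hq⟩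
  have := he i
  rwa [hp0] at this

theorem similarTuple_elim0 (hE : E.IsFiniteCrowded) (hX : IsCompleteExtPartition E X)
    (hX' : IsCompleteExtPartition E X') :
    SimilarTuple X X' (Fin.elim0 : Fin 0 → R) (Fin.elim0 : Fin 0 → R') := by
  intro ε
  rw [eq_univ_of_forall (s := cell (R := R) _ _) fun x i => i.elim0,
    eq_univ_of_forall (s := cell (R := R') _ _) fun x i => i.elim0]
  exact similar_univ hE hX hX'

end Uniqueness
end BooleanIdeals

namespace BooleanIdeals
open Set TopologicalSpace StoneSpace

/-! ### The algebra generated by the closed sets of a partition -/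

theorem derivedSet_biUnion {ι T : Type*} [TopologicalSpace T] {G : Set ι} (hG : G.Finite)
    (X : ι → Set T) : derivedSet (⋃ p ∈ G, X p) = ⋃ p ∈ G, derivedSet (X p) := by
  induction G, hG using Set.Finite.induction_on with
  | empty =>
    simp only [mem_empty_iff_false, iUnion_of_empty, iUnion_empty]
    exact eq_empty_of_forall_notMem fun x hx => by
      obtain ⟨y, hy, -⟩ := accPt_iff_nhds.1 hx univ Filter.univ_mem
      exact hy.2
  | insert _ _ ih => simp only [biUnion_insert, derivedSet_union, ih]

section Atoms

variable {n : ℕ} {t : POTuple.{v} n} {T : Type u} [TopologicalSpace T] {X : t.carrier → Set T}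

/-- The sub-TBA generated by the sets `C i` consists of all unions of parts, since the power set of
the label set is generated by the sets `Q i`. -/
theorem tbaGen_iff (hX : IsCompletePartition t.toPOSystem X) {C : Fin n → Set T}
    (hC : ∀ i, C i = ⋃ p ∈ t.Q i, X p) (A : Set T) :
    TBAGen derivedSet (range C) A ↔ ∃ G : Set t.carrier, A = ⋃ p ∈ G, X p := by
  have := t.finiteCrowded.1
  have hcompl : ∀ G : Set t.carrier, (⋃ p ∈ G, X p)ᶜ = ⋃ p ∈ Gᶜ, X p := by
    intro G
    ext x
    obtain ⟨q, hq⟩ := hX.exists_mem x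
    have : ∀ G' : Set t.carrier, x ∈ ⋃ p ∈ G', X p ↔ q ∈ G' := fun G' => by
      simp only [mem_iUnion, exists_prop]
      exact ⟨fun ⟨r, hr, hxr⟩ => hX.eq_of_mem hq hxr ▸ hr, fun h => ⟨q, h, hq⟩⟩
    rw [mem_compl_iff, this, this, mem_compl_iff]
  have hderiv : ∀ G : Set t.carrier,
      derivedSet (⋃ p ∈ G, X p) = ⋃ p ∈ t.toPOSystem.deriv G, X p := by
    intro G
    rw [derivedSet_biUnion (toFinite G)]
    simp only [hX.derived]
    ext x
    simp only [mem_iUnion, exists_prop, POSystem.deriv, mem_ofPred_eq]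
    exact ⟨fun ⟨p, hp, q, hq, hx⟩ => ⟨q, ⟨p, hp, hq⟩, hx⟩,
      fun ⟨q, ⟨p, hp, hq⟩, hx⟩ => ⟨p, hp, q, hq, hx⟩⟩
  constructor
  · intro h
    induction h with
    | basic h =>
      obtain ⟨i, rfl⟩ := h
      exact ⟨_, hC i⟩
    | univ => exact ⟨univ, by rw [← hX.cover, biUnion_univ]⟩
    | compl _ ih =>
      obtain ⟨G, rfl⟩ := ih
      exact ⟨_, hcompl G⟩
    | union _ _ ih₁ ih₂ =>
      obtain ⟨G, rfl⟩ := ih₁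
      obtain ⟨H, rfl⟩ := ih₂
      exact ⟨G ∪ H, (biUnion_union _ _ _).symm⟩
    | deriv _ ih =>
      obtain ⟨G, rfl⟩ := ih
      exact ⟨_, hderiv G⟩
  · rintro ⟨G, rfl⟩
    have := t.generates G
    induction this with
    | basic h =>
      obtain ⟨i, rfl⟩ := h
      exact .basic ⟨i, hC i⟩
    | univ => rw [biUnion_univ, hX.cover]; exact .univ
    | compl _ ih => rw [← hcompl]; exact .compl ih
    | union _ _ ih₁ ih₂ => rw [biUnion_union]; exact .union ih₁ ih₂
    | deriv _ ih => rw [← hderiv]; exact .deriv ih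

theorem isAtomOf_iff (hX : IsCompletePartition t.toPOSystem X) {C : Fin n → Set T}
    (hC : ∀ i, C i = ⋃ p ∈ t.Q i, X p) (A : Set T) :
    IsAtomOf (TBAGen derivedSet (range C)) A ↔ A ∈ range X := by
  have hpart : ∀ p, TBAGen derivedSet (range C) (X p) := fun p =>
    (tbaGen_iff hX hC _).2 ⟨{p}, by simp⟩
  constructor
  · rintro ⟨hA, ⟨x, hx⟩, hmin⟩
    obtain ⟨G, rfl⟩ := (tbaGen_iff hX hC _).1 hA
    obtain ⟨p, hp, hxp⟩ := mem_iUnion₂.1 hx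
    refine ⟨p, (hmin _ (hpart p) (subset_biUnion_of_mem hp)).resolve_left ?_⟩
    exact (hX.nonempty p).ne_empty
  · rintro ⟨p, rfl⟩
    refine ⟨hpart p, hX.nonempty p, fun B hB hBp => ?_⟩
    obtain ⟨G, rfl⟩ := (tbaGen_iff hX hC _).1 hB
    rcases G.eq_empty_or_nonempty with rfl | ⟨q, hq⟩
    · left; simp
    · have hsub := (subset_biUnion_of_mem (u := X) hq).trans hBp
      obtain ⟨x, hx⟩ := hX.nonempty q
      have := hX.eq_of_mem hx (hsub hx)
      subst this
      exact Or.inr (hBp.antisymm (subset_biUnion_of_mem (u := X) hq))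

end Atoms

/-- The clause about atoms in the definition of `Describes` follows from the other clauses. -/
theorem describes_iff {n : ℕ} {t : POTuple.{v} n} {S : IdealSystem.{u} n} :
    Describes t S ↔ ∃ X : t.carrier → Set (StoneSpace S.carrier),
      IsCompleteExtPartition t.toExtPOSystem X ∧
      ∀ i, closedSet (S.ideal i) = ⋃ p ∈ t.Q i, X p :=
  ⟨fun ⟨X, h1, _, h3⟩ => ⟨X, h1, h3⟩, fun ⟨X, h1, h3⟩ =>
    ⟨X, h1, isAtomOf_iff h1.toIsCompletePartition h3, h3⟩⟩

/-- A ring with ideals is described by at most one tuple up to isomorphism: the labels are the atoms,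
and the remaining data can be read off from them. -/
theorem Describes.iso_left {n : ℕ} {s t : POTuple.{v} n} {S : IdealSystem.{u} n}
    (hs : Describes s S) (ht : Describes t S) : s.Iso t := by
  obtain ⟨X, hX, hXa, hXC⟩ := hs
  obtain ⟨Y, hY, hYa, hYC⟩ := ht
  have hinj : ∀ {r : POTuple.{v} n} {Z : r.carrier → Set (StoneSpace S.carrier)},
      IsCompletePartition r.toPOSystem Z → Function.Injective Z := by
    intro r Z hZ p q hpq
    obtain ⟨x, hx⟩ := hZ.nonempty p
    exact hZ.eq_of_mem hx (hpq ▸ hx)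
  have hXi := hinj hX.toIsCompletePartition
  have hYi := hinj hY.toIsCompletePartition
  have h1 : ∀ p, ∃ q, Y q = X p := fun p => (hYa _).1 ((hXa _).2 ⟨p, rfl⟩)
  have h2 : ∀ q, ∃ p, X p = Y q := fun q => (hXa _).1 ((hYa _).2 ⟨q, rfl⟩)
  choose g hg using h1
  choose g' hg' using h2
  let e : s.carrier ≃ t.carrier :=
    ⟨g, g', fun p => hXi ((hg' _).trans (hg p)), fun q => hYi ((hg _).trans (hg' q))⟩
  have he : ∀ p, Y (e p) = X p := hg
  have hlt : ∀ {r : POTuple.{v} n} {Z : r.carrier → Set (StoneSpace S.carrier)},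
      IsCompletePartition r.toPOSystem Z → ∀ p q, r.lt p q ↔ Z p ⊆ derivedSet (Z q) := by
    intro r Z hZ p q
    refine ⟨fun h x hx => (hZ.mem_derivedSet hx).2 h, fun h => ?_⟩
    obtain ⟨x, hx⟩ := hZ.nonempty p
    exact (hZ.mem_derivedSet hx).1 (h hx)
  have hQ : ∀ {r : POTuple.{v} n} {Z : r.carrier → Set (StoneSpace S.carrier)},
      IsCompletePartition r.toPOSystem Z → (∀ i, closedSet (S.ideal i) = ⋃ p ∈ r.Q i, Z p) →
      ∀ i p, p ∈ r.Q i ↔ Z p ⊆ closedSet (S.ideal i) := by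
    intro r Z hZ hC i p
    rw [hC]
    refine ⟨fun h => subset_biUnion_of_mem (u := Z) h, fun h => ?_⟩
    obtain ⟨x, hx⟩ := hZ.nonempty p
    obtain ⟨q, hq, hxq⟩ := mem_iUnion₂.1 (h hx)
    exact hZ.eq_of_mem hx hxq ▸ hq
  refine ⟨⟨e, fun {p q} => ?_⟩, fun p => ?_, fun i p => ?_, fun p h h' => ?_⟩
  · rw [hlt hX.toIsCompletePartition, hlt hY.toIsCompletePartition, he, he]
  · rw [← hX.compact_iff, ← he, hY.compact_iff]; rfl
  · rw [hQ hX.toIsCompletePartition hXC, ← he, ← hQ hY.toIsCompletePartition hYC]; rfl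
  · have h3 := hX.card_eq ⟨p, h⟩
    have h4 := hY.card_eq ⟨_, h'⟩
    have : Y (e p) = X p := he p
    have h5 : ((t.f ⟨e p, h'⟩ : ℕ) : ℕ∞) = ((s.f ⟨p, h⟩ : ℕ) : ℕ∞) := by
      rw [← h3, ← this]; exact h4.symm
    exact PNat.coe_injective (by exact_mod_cast h5)

/-! ### Invariance of the correspondence under isomorphism -/

theorem IsCompleteExtPartition.image {E : ExtPOSystem.{v}} {T : Type u} {T' : Type w}
    [TopologicalSpace T] [TopologicalSpace T'] (h : T ≃ₜ T') {X : E.carrier → Set T}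
    (hX : IsCompleteExtPartition E X) : IsCompleteExtPartition E fun p => h '' X p where
  nonempty p := (hX.nonempty p).image _
  disjoint p q hpq := (disjoint_image_iff h.injective).2 (hX.disjoint hpq)
  cover := by rw [← image_iUnion, hX.cover, image_univ, h.range_coe]
  derived p := by
    rw [← image_iUnion₂, ← hX.derived]
    refine Subset.antisymm ?_ (h.continuous.image_derivedSet h.injective)
    intro y hy
    obtain ⟨x, rfl⟩ := h.surjective y
    refine ⟨x, ?_, rfl⟩
    have := h.symm.continuous.image_derivedSet h.symm.injective ⟨h x, hy, rfl⟩
    simpa [image_image] using this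
  compact_iff p := by
    rw [← h.image_closure, h.isCompact_image, hX.compact_iff]
  card_eq p := by rw [h.injective.encard_image, hX.card_eq]

/-- The map of Stone spaces induced by a ring isomorphism. -/
def stoneMap {R : Type u} {R' : Type w} [NonUnitalRing R] [NonUnitalRing R'] (e : R ≃+* R')
    (x : StoneSpace R) : StoneSpace R' :=
  ⟨x.1.comp (e.symm : R' →ₙ+* R), fun h => x.2 (NonUnitalRingHom.ext fun a => by
    have := DFunLike.congr_fun h (e a)
    simpa using this)⟩

theorem stoneMap_mem {R : Type u} {R' : Type w} [NonUnitalRing R] [NonUnitalRing R']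
    (e : R ≃+* R') (x : StoneSpace R) (a : R) :
    stoneMap e x ∈ basicOpen (e a) ↔ x ∈ basicOpen a := by
  change x.1 (e.symm (e a)) = 1 ↔ x.1 a = 1
  rw [e.symm_apply_apply]

/-- The homeomorphism of Stone spaces induced by a ring isomorphism. -/
def stoneHomeomorph {R : Type u} {R' : Type w} [NonUnitalRing R] [NonUnitalRing R']
    (e : R ≃+* R') : StoneSpace R ≃ₜ StoneSpace R' where
  toFun := stoneMap e
  invFun := stoneMap e.symm
  left_inv x := stone_ext fun a => by
    have := stoneMap_mem e.symm (stoneMap e x) (e a)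
    rw [e.symm_apply_apply] at this
    rw [this, stoneMap_mem]
  right_inv x := stone_ext fun a => by
    have := stoneMap_mem e (stoneMap e.symm x) (e.symm a)
    rw [e.apply_symm_apply] at this
    rw [this, stoneMap_mem]
  continuous_toFun := by
    refine continuous_generateFrom_iff.2 ?_
    rintro _ ⟨b, rfl⟩
    obtain ⟨a, rfl⟩ := e.surjective b
    convert isOpen_basicOpen a using 1
    ext x
    exact stoneMap_mem e x a
  continuous_invFun := by
    refine continuous_generateFrom_iff.2 ?_
    rintro _ ⟨b, rfl⟩
    obtain ⟨a, rfl⟩ := e.symm.surjective b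
    convert isOpen_basicOpen a using 1
    ext x
    exact stoneMap_mem e.symm x a

theorem stoneHomeomorph_mem {R : Type u} {R' : Type w} [NonUnitalRing R] [NonUnitalRing R']
    (e : R ≃+* R') (x : StoneSpace R) (a : R) :
    stoneHomeomorph e x ∈ basicOpen (e a) ↔ x ∈ basicOpen a := stoneMap_mem e x a

theorem image_closedSet {R : Type u} {R' : Type w} [NonUnitalRing R] [NonUnitalRing R']
    (e : R ≃+* R') {J : TwoSidedIdeal R} {J' : TwoSidedIdeal R'} (h : ∀ a, a ∈ J ↔ e a ∈ J') :
    stoneHomeomorph e '' closedSet J = closedSet J' := by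
  ext y
  obtain ⟨x, rfl⟩ := (stoneHomeomorph e).surjective y
  rw [(stoneHomeomorph e).injective.mem_set_image, mem_closedSet, mem_closedSet]
  refine ⟨fun hx b hb => ?_, fun hx a ha => ?_⟩
  · obtain ⟨a, rfl⟩ := e.surjective b
    rw [stoneHomeomorph_mem]
    exact hx a ((h a).2 hb)
  · rw [← stoneHomeomorph_mem e]
    exact hx _ ((h a).1 ha)

theorem Describes.of_iso {n : ℕ} {t : POTuple.{v} n} {S S' : IdealSystem.{u} n}
    (h : Describes t S) (hSS' : S.Iso S') : Describes t S' := by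
  obtain ⟨X, hX, hC⟩ := describes_iff.1 h
  obtain ⟨e, he⟩ := hSS'
  refine describes_iff.2 ⟨_, hX.image (stoneHomeomorph e), fun i => ?_⟩
  rw [← image_closedSet e (he i), hC, image_iUnion₂]

theorem Describes.of_iso_left {n : ℕ} {s t : POTuple.{v} n} {S : IdealSystem.{u} n}
    (h : Describes s S) (hst : s.Iso t) : Describes t S := by
  obtain ⟨X, hX, hC⟩ := describes_iff.1 h
  obtain ⟨θ, hL, hQ, hf⟩ := hst
  have hun : ∀ (F : Set s.carrier) (G : Set t.carrier), (∀ p, p ∈ F ↔ θ p ∈ G) →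
      ⋃ p ∈ F, X p = ⋃ q ∈ G, X (θ.symm q) := by
    intro F G hFG
    ext x
    simp only [mem_iUnion, exists_prop]
    exact ⟨fun ⟨p, hp, hx⟩ => ⟨θ p, (hFG p).1 hp, by simpa using hx⟩,
      fun ⟨q, hq, hx⟩ => ⟨θ.symm q, (hFG _).2 (by simpa using hq), hx⟩⟩
  refine describes_iff.2 ⟨fun q => X (θ.symm q), ⟨⟨fun q => hX.nonempty _,
    fun q r hqr => hX.disjoint (θ.symm.injective.ne hqr), ?_, fun q => ?_⟩, fun q => ?_,
    fun q => ?_⟩, fun i => ?_⟩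
  · rw [← hX.cover]
    exact θ.symm.surjective.iUnion_comp X
  · rw [hX.derived]
    refine hun _ _ fun p => ?_
    rw [mem_ofPred_eq, mem_ofPred_eq, ← θ.map_rel_iff, RelIso.apply_symm_apply]
  · rw [hX.compact_iff, hL, RelIso.apply_symm_apply]
  · have hq : θ (θ.symm q) ∈ t.minimals t.L ∩ t.discrete := by
      rw [RelIso.apply_symm_apply]; exact q.2
    have hp := (POTuple.mem_dom_iff θ hL _).2 hq
    have h1 := hX.card_eq ⟨_, hp⟩
    rw [h1, ← hf _ hp hq]
    congr 3
    exact Subtype.ext (by simp)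
  · rw [hC]
    exact hun _ _ fun p => hQ i p

end BooleanIdeals

namespace BooleanIdeals
open Set TopologicalSpace StoneSpace

/-! ### A space of paths with a prescribed complete partition -/

namespace ExtPOSystem

variable (E : ExtPOSystem.{v})

/-- The set indexing the starting points with label `p` of the paths below: it has `f p` elements
where `f` is defined, one element for the other `p ∈ L`, and is infinite for `p ∉ L`. -/
def startIndex (p : E.carrier) : Set ℕ :=
  {k | (∀ h : p ∈ E.minimals E.L ∩ E.discrete, k < E.f ⟨p, h⟩) ∧
    (p ∈ E.L → p ∉ E.discrete → k = 0)}

/-- The points of the space to be constructed: sequences of labels `(p, k)`. From a label `p` the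
sequence may either stay, moving to `(p, 0)`, or jump to `(q, 1)` for any `q` with `p < q`. Thus
a path with label `p < p` can stay in two ways, and one with label `p ∈ Pᵈ` in one way only. -/
def Path : Type v :=
  {x : ℕ → E.carrier × ℕ // (x 0).2 ∈ E.startIndex (x 0).1 ∧
    ∀ m, (x (m + 1)).2 = 0 ∧ (x (m + 1)).1 = (x m).1 ∨
      (x (m + 1)).2 = 1 ∧ E.lt (x m).1 (x (m + 1)).1}

variable {E}

/-- Two paths agree up to time `m`. -/
def Path.Agree (m : ℕ) (x y : E.Path) : Prop := ∀ j ≤ m, x.1 j = y.1 j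

/-- The paths whose label is eventually `p`. -/
def part (p : E.carrier) : Set E.Path := {x | ∃ m, ∀ j ≥ m, (x.1 j).1 = p}

theorem zero_mem_startIndex (p : E.carrier) : 0 ∈ E.startIndex p :=
  ⟨fun _ => PNat.pos _, fun _ _ => rfl⟩

/-- The path with constant label. -/
def constPath {p : E.carrier} {k : ℕ} (hk : k ∈ E.startIndex p) : E.Path :=
  ⟨fun j => (p, if j = 0 then k else 0), by simpa using hk, fun m => by simp⟩

theorem constPath_mem_part {p : E.carrier} {k : ℕ} (hk : k ∈ E.startIndex p) :
    constPath hk ∈ part p := ⟨0, fun _ _ => rfl⟩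

theorem finite_startIndex (hE : E.IsFiniteCrowded) {p : E.carrier} (hp : p ∈ E.L) :
    (E.startIndex p).Finite := by
  by_cases h : p ∈ E.discrete
  · exact (finite_Iio (E.f ⟨p, hE.2 h, h⟩ : ℕ)).subset fun k hk => hk.1 ⟨hE.2 h, h⟩
  · exact (finite_singleton 0).subset fun k hk => hk.2 hp h

theorem startIndex_eq_univ {p : E.carrier} (hp : p ∉ E.L) : E.startIndex p = univ :=
  eq_univ_of_forall fun _ => ⟨fun h => (hp h.1.1).elim, fun h => (hp h).elim⟩

/-- The labels on a path increase weakly. -/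
theorem Path.label_le (x : E.Path) {i j : ℕ} (hij : i ≤ j) :
    (x.1 i).1 = (x.1 j).1 ∨ E.lt (x.1 i).1 (x.1 j).1 := by
  induction j, hij using Nat.le_induction with
  | base => exact Or.inl rfl
  | succ j _ ih =>
    rcases x.2.2 j with ⟨-, h⟩ | ⟨-, h⟩
    · rwa [h]
    · rcases ih with h1 | h1
      · exact Or.inr (h1 ▸ h)
      · exact Or.inr (E.trans _ _ _ h1 h)

theorem Path.label_le_of_mem_part {x : E.Path} {p : E.carrier} (hx : x ∈ part p) (i : ℕ) :
    (x.1 i).1 = p ∨ E.lt (x.1 i).1 p := by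
  obtain ⟨m, hm⟩ := hx
  have := x.label_le (le_max_right m i)
  rwa [hm _ (le_max_left _ _)] at this

theorem part_disjoint {x : E.Path} {p q : E.carrier} (hp : x ∈ part p) (hq : x ∈ part q) :
    p = q := by
  obtain ⟨m, hm⟩ := hp
  obtain ⟨m', hm'⟩ := hq
  rw [← hm _ (le_max_left m m'), hm' _ (le_max_right m m')]

theorem exists_mem_part (hE : E.IsFiniteCrowded) (x : E.Path) : ∃ p, x ∈ part p := by
  have := hE.1
  let : PartialOrder E.carrier :=
    { le := fun p q => p = q ∨ E.lt p q
      le_refl := fun p => Or.inl rfl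
      le_trans := by
        rintro p q r (rfl | h) (rfl | h')
        exacts [Or.inl rfl, Or.inr h', Or.inr h, Or.inr (E.trans _ _ _ h h')]
      le_antisymm := by
        rintro p q (rfl | h) h'
        · rfl
        · rcases h' with rfl | h'
          exacts [rfl, E.antisymm _ _ h h'] }
  obtain ⟨m, hm⟩ := WellFoundedGT.monotone_chain_condition
    (⟨fun i => (x.1 i).1, fun i j hij => x.label_le hij⟩ : ℕ →o E.carrier)
  exact ⟨(x.1 m).1, m, fun j hj => (hm j hj).symm⟩

/-- Once a path has reached its final label `p`, and if `p < p` fails, it is determined. -/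
theorem Path.eq_of_agree {x y : E.Path} {p : E.carrier} (hp : p ∈ E.discrete) {m : ℕ}
    (hxy : x.Agree m y) (hm : (x.1 m).1 = p) (hx : x ∈ part p) (hy : y ∈ part p) : x = y := by
  have hstay : ∀ z : E.Path, z ∈ part p → (z.1 m).1 = p → ∀ d, z.1 (m + d + 1) = (p, 0) := by
    intro z hz hzm d
    have hlab : ∀ j ≥ m, (z.1 j).1 = p := by
      intro j hj
      rcases z.label_le hj with h | h
      · rw [← h, hzm]
      · rw [hzm] at h
        rcases Path.label_le_of_mem_part hz j with h' | h'
        · exact h'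
        · exact (E.antisymm _ _ h h').symm
    rcases z.2.2 (m + d) with ⟨h1, h2⟩ | ⟨-, h⟩
    · exact Prod.ext (hlab _ (by omega)) h1
    · rw [hlab _ (by omega), hlab _ (by omega)] at h
      exact (hp h).elim
  refine Subtype.ext (funext fun j => ?_)
  rcases le_or_gt j m with hj | hj
  · exact hxy j hj
  · obtain ⟨d, rfl⟩ := Nat.exists_eq_add_of_lt hj
    rw [hstay x hx hm, hstay y hy (by rw [← hxy m le_rfl, hm])]

/-- The path that follows `x` up to time `m`, then jumps to the label `p` and stays there. -/
noncomputable def Path.jump (x : E.Path) (m : ℕ) {p : E.carrier} (h : E.lt (x.1 m).1 p) : E.Path :=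
  ⟨fun j => if j ≤ m then x.1 j else (p, if j = m + 1 then 1 else 0), by simpa using x.2.1,
    fun j => by
      rcases lt_trichotomy j m with hj | rfl | hj
      · simpa [hj.le, Nat.succ_le_of_lt hj] using x.2.2 j
      · simp [h]
      · have h1 : ¬ j ≤ m := by omega
        have h2 : ¬ j + 1 ≤ m := by omega
        have h3 : j ≠ m := by omega
        simp [h1, h2, h3]⟩

theorem Path.jump_agree (x : E.Path) (m : ℕ) {p : E.carrier} (h : E.lt (x.1 m).1 p) :
    x.Agree m (x.jump m h) := fun j hj => by simp [Path.jump, hj]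

theorem Path.jump_mem_part (x : E.Path) (m : ℕ) {p : E.carrier} (h : E.lt (x.1 m).1 p) :
    x.jump m h ∈ part p := ⟨m + 1, fun j hj => by
  have h1 : ¬ j ≤ m := by omega
  simp [Path.jump, h1]⟩

/-- The paths with eventual label `p` accumulate at those with eventual label `q < p`. -/
theorem forall_exists_agree_iff {x : E.Path} {p q : E.carrier} (hq : x ∈ part q) :
    (∀ m, ∃ y ∈ part p, y ≠ x ∧ x.Agree m y) ↔ E.lt q p := by
  constructor
  · intro h
    obtain ⟨m, hm⟩ := id hq
    obtain ⟨y, hy, hyx, hxy⟩ := h m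
    have hlab := Path.label_le_of_mem_part hy m
    rw [← hxy m le_rfl, hm m le_rfl] at hlab
    rcases hlab with rfl | h
    · by_contra hd
      exact hyx (Path.eq_of_agree hd hxy (hm m le_rfl) hq hy).symm
    · exact h
  · intro h m
    obtain ⟨m', hm'⟩ := id hq
    set M := max m m'
    have h1 : E.lt (x.1 M).1 p := by rwa [hm' M (le_max_right _ _)]
    have h2 : E.lt (x.1 (M + 1)).1 p := by rwa [hm' (M + 1) (by omega)]
    -- the jumps at times `M` and `M + 1` cannot both give `x`
    by_cases hx : x.jump M h1 = x
    · refine ⟨x.jump (M + 1) h2, x.jump_mem_part _ h2, fun h3 => ?_,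
        fun j hj => x.jump_agree _ h2 j (by omega)⟩
      have e1 : (x.1 (M + 2)).2 = 0 := by
        rw [← hx]; simp [Path.jump]
      have e2 : (x.1 (M + 2)).2 = 1 := by
        rw [← h3]; simp [Path.jump]
      omega
    · exact ⟨x.jump M h1, x.jump_mem_part _ h1, hx,
        fun j hj => x.jump_agree _ h1 j (by omega)⟩

/-- The starting points with label at most `p`. -/
theorem finite_start (hE : E.IsFiniteCrowded) {p : E.carrier} (hp : p ∈ E.L) :
    {a : E.carrier × ℕ | (a.1 = p ∨ E.lt a.1 p) ∧ a.2 ∈ E.startIndex a.1}.Finite := by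
  have := hE.1
  have hfin : (⋃ q ∈ {q | q = p ∨ E.lt q p}, Prod.mk q '' E.startIndex q).Finite := by
    refine (toFinite _).biUnion fun q hq => (finite_startIndex hE ?_).image _
    rcases hq with rfl | hq
    exacts [hp, E.lower_L p hp q hq]
  refine hfin.subset ?_
  rintro ⟨q, k⟩ ⟨h1, h2⟩
  exact mem_iUnion₂.2 ⟨q, h1, k, h2, rfl⟩

/-- If `p` is minimal in `L` and `¬ p < p`, then the only paths with eventual label `p` are the
constant ones, which are determined by their starting points. -/
theorem encard_part {p : E.carrier} (hp : p ∈ E.minimals E.L ∩ E.discrete) :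
    (part p : Set E.Path).encard = ((E.f ⟨p, hp⟩ : ℕ) : ℕ∞) := by
  have hlab : ∀ x ∈ part p, (x.1 0).1 = p := by
    intro x hx
    rcases Path.label_le_of_mem_part hx 0 with h | h
    · exact h
    · have h1 := hp.1.2 _ (E.lower_L p hp.1.1 _ h) h
      exact h1
  have hinj : InjOn (fun x : E.Path => (x.1 0).2) (part p) := by
    intro x hx y hy hxy
    refine Path.eq_of_agree hp.2 (m := 0) (fun j hj => ?_) (hlab x hx) hx hy
    obtain rfl := Nat.le_zero.1 hj
    exact Prod.ext ((hlab x hx).trans (hlab y hy).symm) hxy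
  rw [← hinj.encard_image]
  have : (fun x : E.Path => (x.1 0).2) '' part p = ↑(Finset.range (E.f ⟨p, hp⟩ : ℕ)) := by
    ext k
    simp only [mem_image, Finset.coe_range, mem_Iio]
    constructor
    · rintro ⟨x, hx, rfl⟩
      have h1 := x.2.1
      rw [hlab x hx] at h1
      exact h1.1 hp
    · intro hk
      have : k ∈ E.startIndex p := ⟨fun _ => hk, fun _ h => (h hp.2).elim⟩
      exact ⟨constPath this, constPath_mem_part this, by simp [constPath]⟩
  rw [this, encard_coe_eq_coe_finsetCard, Finset.card_range]

/-! ### The ring of compact open sets of paths -/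

/-- The sets of paths which depend only on finitely many times and allow finitely many starting
points only. -/
def IsBasicSet (A : Set E.Path) : Prop :=
  (∃ m, ∀ x y, x.Agree m y → (x ∈ A ↔ y ∈ A)) ∧ ((fun x : E.Path => x.1 0) '' A).Finite

theorem Path.Agree.mono {m m' : ℕ} {x y : E.Path} (h : x.Agree m' y) (hm : m ≤ m') : x.Agree m y :=
  fun j hj => h j (hj.trans hm)

theorem IsBasicSet.mul {A B : Set E.Path} (hA : IsBasicSet A) (hB : IsBasicSet B) :
    IsBasicSet (A ∩ B) := by
  obtain ⟨⟨m, hm⟩, hf⟩ := hA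
  obtain ⟨⟨m', hm'⟩, -⟩ := hB
  exact ⟨⟨max m m', fun x y h => and_congr (hm x y (h.mono (le_max_left _ _)))
    (hm' x y (h.mono (le_max_right _ _)))⟩, hf.subset (image_mono inter_subset_left)⟩

theorem IsBasicSet.add {A B : Set E.Path} (hA : IsBasicSet A) (hB : IsBasicSet B) :
    IsBasicSet (symmDiff A B) := by
  obtain ⟨⟨m, hm⟩, hf⟩ := hA
  obtain ⟨⟨m', hm'⟩, hf'⟩ := hB
  refine ⟨⟨max m m', fun x y h => ?_⟩, (hf.union hf').subset ?_⟩
  · have h1 := hm x y (h.mono (le_max_left _ _))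
    have h2 := hm' x y (h.mono (le_max_right _ _))
    simp only [mem_symmDiff, h1, h2]
  · rw [← image_union]
    exact image_mono symmDiff_subset_union

theorem isBasicSet_empty : IsBasicSet (∅ : Set E.Path) := ⟨⟨0, fun _ _ _ => Iff.rfl⟩, by simp⟩

theorem isBasicSet_cylinder (m : ℕ) (x : E.Path) : IsBasicSet {y | x.Agree m y} := by
  refine ⟨⟨m, fun y z h => ⟨fun h1 j hj => (h1 j hj).trans (h j hj),
    fun h1 j hj => (h1 j hj).trans (h j hj).symm⟩⟩, (finite_singleton (x.1 0)).subset ?_⟩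
  rintro _ ⟨y, hy, rfl⟩
  exact (hy 0 (Nat.zero_le _)).symm

variable (E) in
/-- The ring of basic sets of paths. -/
def pathRing : NonUnitalSubring (AsBoolRing (Set E.Path)) where
  carrier := {A | IsBasicSet (ofBoolRing A)}
  add_mem' hA hB := hA.add hB
  zero_mem' := isBasicSet_empty
  mul_mem' hA hB := hA.mul hB
  neg_mem' {A} hA := by
    rw [mem_ofPred_eq, ofBoolRing_neg]; exact hA

/-- At each time a path in a given basic set can have finitely many labels only. -/
theorem IsBasicSet.finite_labels (hE : E.IsFiniteCrowded) {A : Set E.Path} (hA : IsBasicSet A)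
    (j : ℕ) : ((fun x : E.Path => x.1 j) '' A).Finite := by
  have := hE.1
  cases j with
  | zero => exact hA.2
  | succ j =>
    refine ((finite_univ (α := E.carrier)).prod (toFinite {0, 1})).subset ?_
    rintro _ ⟨x, -, rfl⟩
    refine ⟨mem_univ _, ?_⟩
    rcases x.2.2 j with ⟨h, -⟩ | ⟨h, -⟩ <;> simp [h]

theorem countable_pathRing (hE : E.IsFiniteCrowded) : Countable (pathRing E) := by
  have := hE.1
  let g : (Σ m : ℕ, Finset (Fin (m + 1) → E.carrier × ℕ)) → Set E.Path :=
    fun F => {x | (fun j : Fin (F.1 + 1) => x.1 j) ∈ F.2}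
  have hg : ∀ A, IsBasicSet A → ∃ F, g F = A := by
    intro A hA
    obtain ⟨m, hm⟩ := hA.1
    have hfin : ((fun (x : E.Path) (j : Fin (m + 1)) => x.1 j) '' A).Finite := by
      refine (Finite.pi' (ι := Fin (m + 1)) fun j => hA.finite_labels hE j).subset ?_
      rintro _ ⟨x, hx, rfl⟩ j
      exact ⟨x, hx, rfl⟩
    refine ⟨⟨m, hfin.toFinset⟩, Set.ext fun x => ?_⟩
    simp only [g, mem_ofPred_eq, Finite.mem_toFinset, mem_image]
    refine ⟨fun ⟨y, hy, hyx⟩ => ?_, fun hx => ⟨x, hx, rfl⟩⟩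
    exact (hm y x fun j hj => congrFun hyx ⟨j, Nat.lt_succ_of_le hj⟩).1 hy
  have : Function.Injective fun A : pathRing E => (hg (ofBoolRing A.1) A.2).choose := by
    intro A B hAB
    have h1 := (hg (ofBoolRing A.1) A.2).choose_spec
    have h2 := (hg (ofBoolRing B.1) B.2).choose_spec
    dsimp only at hAB
    rw [hAB] at h1
    exact Subtype.ext (ofBoolRing_inj.1 (h1.symm.trans h2))
  exact this.countable

/-- A family of nonempty basic sets that is directed downwards has a common point, by
compactness. -/
theorem exists_common_path (hE : E.IsFiniteCrowded) {ι : Type*} [Nonempty ι] (A : ι → Set E.Path)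
    (hA : ∀ i, IsBasicSet (A i)) (hne : ∀ i, (A i).Nonempty)
    (hdir : ∀ i j, ∃ k, A k ⊆ A i ∩ A j) : ∃ x, ∀ i, x ∈ A i := by
  let : TopologicalSpace (E.carrier × ℕ) := ⊥
  have : DiscreteTopology (E.carrier × ℕ) := ⟨rfl⟩
  have hcl : ∀ i, IsClosed (Subtype.val '' A i : Set (ℕ → E.carrier × ℕ)) := by
    intro i
    refine isClosed_of_closure_subset fun s hs => ?_
    have happ : ∀ m, ∃ x ∈ A i, ∀ j ≤ m, x.1 j = s j := by
      intro m
      have ho : IsOpen ((Iic m).pi fun j => ({s j} : Set (E.carrier × ℕ))) :=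
        isOpen_set_pi (finite_Iic m) fun j _ => isOpen_discrete _
      obtain ⟨_, h1, ⟨x, hx, rfl⟩⟩ := mem_closure_iff.1 hs _ ho fun j _ => rfl
      exact ⟨x, hx, fun j hj => h1 j hj⟩
    let y : E.Path := ⟨s, by
      obtain ⟨x, -, hx⟩ := happ 0
      rw [← hx 0 le_rfl]; exact x.2.1, fun m => by
      obtain ⟨x, -, hx⟩ := happ (m + 1)
      rw [← hx (m + 1) le_rfl, ← hx m (by omega)]; exact x.2.2 m⟩
    obtain ⟨m, hm⟩ := (hA i).1
    obtain ⟨x, hx, hxs⟩ := happ m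
    exact ⟨y, (hm x y hxs).1 hx, rfl⟩
  obtain ⟨s, hs⟩ := IsCompact.nonempty_iInter_of_directed_nonempty_isCompact_isClosed
    (fun i => (Subtype.val '' A i : Set (ℕ → E.carrier × ℕ)))
    (fun i j => by
      obtain ⟨k, hk⟩ := hdir i j
      exact ⟨k, image_mono (hk.trans inter_subset_left),
        image_mono (hk.trans inter_subset_right)⟩)
    (fun i => (hne i).image _)
    (fun i => (isCompact_univ_pi (s := fun j => (fun x : E.Path => x.1 j) '' A i) fun j =>
      ((hA i).finite_labels hE j).isCompact).of_isClosed_subset (hcl i) (by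
        rintro _ ⟨x, hx, rfl⟩ j -
        exact ⟨x, hx, rfl⟩))
    hcl
  obtain ⟨x, -, hx⟩ := mem_iInter.1 hs (Classical.arbitrary ι)
  refine ⟨x, fun i => ?_⟩
  obtain ⟨y, hy, hys⟩ := mem_iInter.1 hs i
  rwa [Subtype.ext (hx.trans hys.symm)]

/-- If a ring is isomorphic to the ring of basic sets of paths, then its Stone space has a
complete partition of the given kind. -/
theorem exists_isCompleteExtPartition (hE : E.IsFiniteCrowded) {S : Type u} [NonUnitalRing S]
    (e : S ≃+* pathRing E) :
    ∃ X : E.carrier → Set (StoneSpace S), IsCompleteExtPartition E X := by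
  let ρ : S → Set E.Path := fun a => ofBoolRing (e a).1
  have hρ : ∀ a, IsBasicSet (ρ a) := fun a => (e a).2
  have hρs : ∀ A, IsBasicSet A → ∃ a, ρ a = A := fun A hA =>
    ⟨e.symm ⟨toBoolRing A, hA⟩, by simp [ρ]⟩
  have hmul : ∀ a b x, x ∈ ρ (a * b) ↔ x ∈ ρ a ∧ x ∈ ρ b := fun a b x => by
    simp only [ρ, map_mul]; exact Iff.rfl
  have hadd : ∀ a b x, x ∈ ρ (a + b) ↔ ¬(x ∈ ρ a ↔ x ∈ ρ b) := fun a b x => by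
    have : ρ (a + b) = symmDiff (ρ a) (ρ b) := by simp only [ρ, map_add]; rfl
    rw [this, mem_symmDiff]; tauto
  have hzero : ∀ a, ρ a = ∅ → a = 0 := by
    intro a ha
    refine e.injective (Subtype.ext (ofBoolRing_inj.1 ?_))
    rw [map_zero]
    exact ha
  have hex : ∀ x : E.Path, ∃ a, x ∈ ρ a := fun x => by
    obtain ⟨a, ha⟩ := hρs _ (isBasicSet_cylinder 0 x)
    exact ⟨a, by rw [ha]; exact fun _ _ => rfl⟩
  let pt : E.Path → StoneSpace S := fun x =>
    pointOfPred (fun a => x ∈ ρ a) (fun a b => hmul a b x) (fun a b => hadd a b x) (hex x)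
  have hpt : ∀ x a, pt x ∈ basicOpen a ↔ x ∈ ρ a := fun x a => pointOfPred_mem _ _ _ a
  have hcyl : ∀ x y m, x.Agree m y ∨ ∃ a, x ∈ ρ a ∧ y ∉ ρ a := by
    intro x y m
    by_contra! h
    obtain ⟨a, ha⟩ := hρs _ (isBasicSet_cylinder m x)
    have := h.2 a (by rw [ha]; exact fun _ _ => rfl)
    rw [ha] at this
    exact h.1 this
  have hinj : Function.Injective pt := by
    intro x y hxy
    refine Subtype.ext (funext fun m => ?_)
    refine ((hcyl x y m).resolve_right ?_) m le_rfl
    rintro ⟨a, h1, h2⟩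
    rw [← hpt, hxy, hpt] at h1
    exact h2 h1
  have hsurj : Function.Surjective pt := by
    intro φ
    obtain ⟨a₀, ha₀⟩ := exists_mem_basicOpen φ
    have : Nonempty {a : S // φ ∈ basicOpen a} := ⟨⟨a₀, ha₀⟩⟩
    obtain ⟨x, hx⟩ := exists_common_path hE (fun a : {a : S // φ ∈ basicOpen a} => ρ a.1)
      (fun a => hρ a.1)
      (fun a => by
        rw [nonempty_iff_ne_empty]
        intro h
        have := a.2
        rw [hzero _ h] at this
        exact notMem_basicOpen_zero _ this)
      (fun a b => ⟨⟨a.1 * b.1, (mem_basicOpen_mul _ _ _).2 ⟨a.2, b.2⟩⟩,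
        fun x hx => (hmul _ _ _).1 hx⟩)
    refine ⟨x, stone_ext fun a => ?_⟩
    rw [hpt]
    refine ⟨fun h => ?_, fun h => hx ⟨a, h⟩⟩
    by_contra hφ
    have h1 : φ ∈ basicOpen (diff a₀ a) := by rw [basicOpen_diff]; exact ⟨ha₀, hφ⟩
    have h2 := (hpt x _).2 (hx ⟨_, h1⟩)
    rw [basicOpen_diff] at h2
    exact h2.2 ((hpt x a).2 h)
  refine ⟨fun p => pt '' part p, ⟨⟨fun p => ?_, fun p q hpq => ?_, ?_, fun p => ?_⟩, fun p => ?_,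
    fun p => ?_⟩⟩
  · exact ⟨_, _, constPath_mem_part (zero_mem_startIndex p), rfl⟩
  · refine (disjoint_image_iff hinj).2 (disjoint_left.2 fun x hp hq => hpq (part_disjoint hp hq))
  · rw [← image_iUnion]
    refine eq_univ_of_forall fun φ => ?_
    obtain ⟨x, rfl⟩ := hsurj φ
    obtain ⟨p, hp⟩ := exists_mem_part hE x
    exact ⟨x, mem_iUnion.2 ⟨p, hp⟩, rfl⟩
  · ext φ
    obtain ⟨x, rfl⟩ := hsurj φ
    obtain ⟨q, hq⟩ := exists_mem_part hE x
    have h1 : pt x ∈ ⋃ q ∈ {q | E.lt q p}, pt '' part q ↔ E.lt q p := by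
      simp only [mem_iUnion, hinj.mem_set_image, mem_ofPred_eq, exists_prop]
      exact ⟨fun ⟨r, hr, hx⟩ => part_disjoint hq hx ▸ hr, fun h => ⟨q, h, hq⟩⟩
    rw [h1, ← forall_exists_agree_iff hq, mem_derivedSet_iff]
    constructor
    · intro h m
      obtain ⟨a, ha⟩ := hρs _ (isBasicSet_cylinder m x)
      obtain ⟨_, ⟨y, hy, rfl⟩, hyx, hya⟩ := h a ((hpt _ _).2 (by rw [ha]; exact fun _ _ => rfl))
      rw [hpt, ha] at hya
      exact ⟨y, hy, fun h => hyx (h ▸ rfl), hya⟩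
    · intro h a ha
      obtain ⟨m, hm⟩ := (hρ a).1
      obtain ⟨y, hy, hyx, hxy⟩ := h m
      exact ⟨pt y, ⟨y, hy, rfl⟩, hinj.ne hyx, (hpt _ _).2 ((hm x y hxy).1 ((hpt _ _).1 ha))⟩
  · rw [isCompact_closure_iff]
    constructor
    · rintro ⟨a, ha⟩
      by_contra hp
      have hk : ∀ k, k ∈ E.startIndex p := fun k => by rw [startIndex_eq_univ hp]; trivial
      refine infinite_of_injective_forall_mem (f := fun k : ℕ => (p, k))
        (fun k l h => (Prod.mk.inj h).2) (fun k => ?_) (hρ a).2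
      refine ⟨constPath (hk k), (hpt _ _).1 (ha ⟨_, constPath_mem_part (hk k), rfl⟩), ?_⟩
      simp [constPath]
    · intro hp
      obtain ⟨a, ha⟩ := hρs {x | x.1 0 ∈ {a : E.carrier × ℕ | (a.1 = p ∨ E.lt a.1 p) ∧
          a.2 ∈ E.startIndex a.1}}
        ⟨⟨0, fun x y h => by simp only [mem_ofPred_eq, h 0 le_rfl]⟩,
          (finite_start hE hp).subset (by rintro _ ⟨x, hx, rfl⟩; exact hx)⟩
      refine ⟨a, ?_⟩
      rintro _ ⟨x, hx, rfl⟩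
      rw [hpt, ha]
      exact ⟨Path.label_le_of_mem_part hx 0, x.2.1⟩
  · rw [hinj.encard_image, encard_part p.2]

end ExtPOSystem

open ExtPOSystem in
/-- Every tuple describes a countable Boolean ring with ideals. -/
theorem exists_describes {n : ℕ} (t : POTuple.{v} n) :
    ∃ S : IdealSystem.{u} n, Countable S.carrier ∧ Describes t S := by
  have hE := t.finiteCrowded
  have := hE.1
  have := countable_pathRing hE
  obtain ⟨X, hX⟩ := exists_isCompleteExtPartition hE
    (Shrink.ringEquiv.{u} (pathRing t.toExtPOSystem))
  refine ⟨⟨Shrink.{u} (pathRing t.toExtPOSystem), fun a => ?_, fun i =>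
    idealOf (⋃ p ∈ t.Q i, X p)⟩,
    (equivShrink.{u} (pathRing t.toExtPOSystem)).symm.injective.countable,
    describes_iff.2 ⟨X, hX, fun i => ?_⟩⟩
  · refine (Shrink.ringEquiv.{u} (pathRing t.toExtPOSystem)).injective ?_
    rw [map_mul]
    exact Subtype.ext (BooleanRing.mul_self _)
  · refine closedSet_idealOf ?_
    have := hX.isClosed_inter isClosed_univ (G := t.Q i)
      fun p hp q hq _ => t.lower_Q i p hp q hq
    rwa [univ_inter] at this

end BooleanIdeals

namespace BooleanIdeals
open Set TopologicalSpace StoneSpace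

/-! ### Finite algebras of sets closed under derivatives -/

section Tuple

theorem TBAGen.biUnion {α : Type u} {d : Set α → Set α} {G : Set (Set α)} {ι : Type*} {F : Set ι}
    (hF : F.Finite) {X : ι → Set α} (hX : ∀ i ∈ F, TBAGen d G (X i)) :
    TBAGen d G (⋃ i ∈ F, X i) := by
  induction F, hF using Set.Finite.induction_on with
  | empty =>
    have := (TBAGen.univ (d := d) (G := G)).compl
    simpa using this
  | insert _ _ ih =>
    rw [biUnion_insert]
    exact (hX _ (mem_insert _ _)).union (ih fun i hi => hX i (mem_insert_of_mem _ hi))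

/-- If the sub-TBA generated by `G` is finite, then its atoms form a partition. -/
theorem exists_atoms {α : Type u} {d : Set α → Set α} {G : Set (Set α)}
    (hfin : {A | TBAGen d G A}.Finite) :
    ∃ (N : ℕ) (X : Fin N → Set α), (∀ p, (X p).Nonempty) ∧ (∀ x, ∃ p, x ∈ X p) ∧
      (∀ p, TBAGen d G (X p)) ∧
      (∀ B, TBAGen d G B → ∀ p, ∀ x ∈ X p, x ∈ B → X p ⊆ B) ∧
      ∀ p q, ∀ x, x ∈ X p → x ∈ X q → p = q := by
  let atom : α → Set α := fun x => (⋃ A ∈ {A | TBAGen d G A ∧ x ∉ A}, A)ᶜ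
  have hatom : ∀ x, TBAGen d G (atom x) := fun x =>
    (TBAGen.biUnion (X := fun A => A) (hfin.subset fun A hA => hA.1) fun A hA => hA.1).compl
  have hself : ∀ x, x ∈ atom x := fun x hx => by
    obtain ⟨A, hA, hxA⟩ := mem_iUnion₂.1 hx
    exact hA.2 hxA
  have hmin : ∀ B, TBAGen d G B → ∀ x, x ∈ B → atom x ⊆ B := by
    intro B hB x hx y hy
    by_contra hyB
    exact hy (mem_iUnion₂.2 ⟨Bᶜ, ⟨hB.compl, fun h => h hx⟩, hyB⟩)
  have hsymm : ∀ x y, y ∈ atom x → atom y = atom x := by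
    intro x y hy
    refine (hmin _ (hatom x) y hy).antisymm (hmin _ (hatom y) x ?_)
    by_contra hx
    exact hmin _ (hatom y).compl x hx hy (hself y)
  have hfr : (range atom).Finite := hfin.subset (by rintro _ ⟨x, rfl⟩; exact hatom x)
  have := hfr.to_subtype
  obtain ⟨N, ⟨e⟩⟩ := Finite.exists_equiv_fin (range atom)
  obtain ⟨X, hXdef⟩ : ∃ X : Fin N → Set α, ∀ p, X p = (e.symm p).1 := ⟨_, fun _ => rfl⟩
  have hX : ∀ p, ∃ x, atom x = X p := fun p => by
    rw [hXdef]
    exact (e.symm p).2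
  refine ⟨N, X, fun p => ?_, fun x => ⟨e ⟨_, mem_range_self x⟩, ?_⟩, fun p => ?_,
    fun B hB p y hy hyB => ?_, fun p q x hp hq => ?_⟩
  · obtain ⟨x, hx⟩ := hX p
    exact ⟨x, by rw [← hx]; exact hself x⟩
  · rw [hXdef, e.symm_apply_apply]; exact hself x
  · obtain ⟨x, hx⟩ := hX p
    rw [← hx]; exact hatom x
  · obtain ⟨x, hx⟩ := hX p
    rw [← hx] at hy ⊢
    rw [← hsymm x y hy]
    exact hmin B hB y hyB
  · obtain ⟨y, hy⟩ := hX p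
    obtain ⟨z, hz⟩ := hX q
    refine e.symm.injective (Subtype.ext ?_)
    rw [← hXdef, ← hXdef, ← hy, ← hz, ← hsymm y x (hy ▸ hp), hsymm z x (hz ▸ hq)]

variable {T : Type u} [TopologicalSpace T]

theorem derivedSet_derivedSet_subset [T1Space T] (A : Set T) :
    derivedSet (derivedSet A) ⊆ derivedSet A :=
  (isClosed_iff_derivedSet_subset _).1 (isClosed_derivedSet A)

theorem _root_.Set.Finite.derivedSet_eq_empty [T1Space T] {A : Set T} (hA : A.Finite) :
    derivedSet A = ∅ := by
  refine eq_empty_of_forall_notMem fun x hx => ?_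
  obtain ⟨y, ⟨h1, h2⟩, h3⟩ := accPt_iff_nhds.1 hx (A \ {x})ᶜ
    ((hA.subset sdiff_subset).isClosed.isOpen_compl.mem_nhds fun h => h.2 rfl)
  exact h1 ⟨h2, h3⟩

/-- A finite sub-TBA generated by closed sets, in which the discrete members are finite, comes from
a finite-crowded extended PO system: `q < p` means that `X q` lies in the derivative of `X p`. -/
theorem exists_tuple [T1Space T] {n : ℕ} {C : Fin n → Set T} (hC : ∀ i, IsClosed (C i))
    (hfin : {A | TBAGen derivedSet (range C) A}.Finite)
    (hdisc : ∀ A, TBAGen derivedSet (range C) A → Disjoint A (derivedSet A) → A.Finite) :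
    ∃ (t : POTuple.{v} n) (X : t.carrier → Set T),
      IsCompleteExtPartition t.toExtPOSystem X ∧ ∀ i, C i = ⋃ p ∈ t.Q i, X p := by
  obtain ⟨N, X₀, hne, hcover, hgen, hdich, hinj⟩ := exists_atoms hfin
  let X : ULift.{v} (Fin N) → Set T := fun p => X₀ p.down
  have hXne : ∀ p, (X p).Nonempty := fun p => hne _
  have hXinj : ∀ {p q x}, x ∈ X p → x ∈ X q → p = q := fun {p q x} hp hq =>
    ULift.ext _ _ (hinj _ _ x hp hq)
  have hXd : ∀ {B}, TBAGen derivedSet (range C) B → ∀ {p x}, x ∈ X p → x ∈ B → X p ⊆ B :=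
    fun {B} hB {p x} hp hx => hdich B hB _ x hp hx
  have hXc : ∀ x, ∃ p, x ∈ X p := fun x => by
    obtain ⟨p, hp⟩ := hcover x
    exact ⟨⟨p⟩, hp⟩
  have hXg : ∀ p, TBAGen derivedSet (range C) (X p) := fun p => hgen _
  -- labels that lie below each other cannot be separated by a member of the algebra
  have hsep : ∀ B, TBAGen derivedSet (range C) B → ∀ p q, X p ⊆ derivedSet (X q) →
      X q ⊆ derivedSet (X p) → X p ⊆ B → X q ⊆ B := by
    intro B hB
    induction hB with
    | basic h =>
      obtain ⟨i, rfl⟩ := h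
      intro p q _ hqp hp
      exact (hqp.trans (derivedSet_mono _ _ hp)).trans
        ((isClosed_iff_derivedSet_subset _).1 (hC i))
    | univ => exact fun _ _ _ _ _ => subset_univ _
    | compl hB ih =>
      intro p q hpq hqp hp
      obtain ⟨y, hy⟩ := hXne q
      refine hXd hB.compl hy fun hyB => ?_
      obtain ⟨x, hx⟩ := hXne p
      exact hp hx (ih q p hqp hpq (hXd hB hy hyB) hx)
    | union hA hB ihA ihB =>
      intro p q hpq hqp hp
      obtain ⟨x, hx⟩ := hXne p
      rcases hp hx with h | h
      · exact (ihA p q hpq hqp (hXd hA hx h)).trans subset_union_left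
      · exact (ihB p q hpq hqp (hXd hB hx h)).trans subset_union_right
    | deriv _ _ =>
      intro p q _ hqp hp
      exact (hqp.trans (derivedSet_mono _ _ hp)).trans (derivedSet_derivedSet_subset _)
  have hanti : ∀ p q, X p ⊆ derivedSet (X q) → X q ⊆ derivedSet (X p) → p = q := by
    intro p q hpq hqp
    obtain ⟨x, hx⟩ := hXne q
    exact (hXinj hx (hsep _ (hXg p) p q hpq hqp Subset.rfl hx)).symm
  let P : POSystem.{v} :=
    { carrier := ULift.{v} (Fin N)
      lt := fun p q => X p ⊆ derivedSet (X q)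
      trans := fun p q r hpq hqr =>
        (hpq.trans (derivedSet_mono _ _ hqr)).trans (derivedSet_derivedSet_subset _)
      antisymm := hanti }
  have hlt : ∀ {p q : P.carrier} {x : T}, x ∈ X p → (x ∈ derivedSet (X q) ↔ P.lt p q) :=
    fun {p q x} hx => ⟨fun h => hXd (hXg q).deriv hx h, fun h => h hx⟩
  have hP : IsCompletePartition P X :=
    { nonempty := hXne
      disjoint := fun p q hpq => disjoint_left.2 fun x hp hq => hpq (hXinj hp hq)
      cover := eq_univ_of_forall fun x => mem_iUnion.2 (hXc x)
      derived := fun p => by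
        ext x
        obtain ⟨q, hq⟩ := hXc x
        rw [hlt hq]
        simp only [mem_iUnion, mem_ofPred_eq, exists_prop]
        exact ⟨fun h => ⟨q, h, hq⟩, fun ⟨r, hr, hx⟩ => hXinj hq hx ▸ hr⟩ }
  have hPfin : ∀ p ∈ P.discrete, (X p).Finite := by
    intro p hp
    refine hdisc _ (hXg p) (disjoint_left.2 fun x hx hx' => hp ?_)
    exact (hlt hx).1 hx'
  have hQ : ∀ B, TBAGen derivedSet (range C) B → B = ⋃ p ∈ {p | X p ⊆ B}, X p := by
    intro B hB
    refine Subset.antisymm (fun x hx => ?_) (iUnion₂_subset fun p hp => hp)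
    obtain ⟨p, hp⟩ := hXc x
    exact mem_iUnion₂.2 ⟨p, hXd hB hp hx, hp⟩
  let E : ExtPOSystem.{v} :=
    { P with
      L := {p | IsCompact (closure (X p))}
      lower_L := fun p hp q hqp => by
        refine IsCompact.of_isClosed_subset hp isClosed_closure ?_
        exact closure_minimal (Subset.trans hqp (derivedSet_subset_closure _)) isClosed_closure
      f := fun p => ⟨(X p.1).ncard, (ncard_pos (hPfin p.1 p.2.2)).2 (hXne _)⟩ }
  have hE : IsCompleteExtPartition E X :=
    { hP with
      compact_iff := fun p => Iff.rfl
      card_eq := fun p => ((hPfin p.1 p.2.2).cast_ncard_eq).symm }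
  let t : POTuple.{v} n :=
    { E with
      finiteCrowded := by
        refine ⟨inferInstanceAs (Finite (ULift (Fin N))), fun p hp => ⟨?_, fun q _ hqp => ?_⟩⟩
        · change IsCompact (closure (X p))
          rw [(hPfin p hp).isClosed.closure_eq]
          exact (hPfin p hp).isCompact
        · obtain ⟨x, hx⟩ := hXne q
          have : x ∈ derivedSet (X p) := hqp hx
          rw [(hPfin p hp).derivedSet_eq_empty] at this
          exact this.elim
      Q := fun i => {p | X p ⊆ C i}
      lower_Q := fun i p hp q hqp => Subset.trans (Subset.trans hqp (derivedSet_mono _ _ hp))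
        ((isClosed_iff_derivedSet_subset _).1 (hC i))
      generates := by
        have key : ∀ B, TBAGen derivedSet (range C) B →
            TBAGen P.deriv (range fun i => {p : P.carrier | X p ⊆ C i})
              {p : P.carrier | X p ⊆ B} := by
          intro B hB
          induction hB with
          | basic h =>
            obtain ⟨i, rfl⟩ := h
            exact .basic ⟨i, rfl⟩
          | univ =>
            have : {p : P.carrier | X p ⊆ Set.univ} = Set.univ :=
              eq_univ_of_forall fun p => subset_univ _
            rw [this]; exact .univ
          | @compl B hB ih =>
            have : {p : P.carrier | X p ⊆ Bᶜ} = {p : P.carrier | X p ⊆ B}ᶜ := by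
              ext p
              obtain ⟨x, hx⟩ := hXne p
              refine ⟨fun h h' => h hx (h' hx), fun h => hXd hB.compl hx fun hxB => ?_⟩
              exact h (hXd hB hx hxB)
            rw [this]; exact .compl ih
          | @union A B hA hB ihA ihB =>
            have : {p : P.carrier | X p ⊆ A ∪ B} =
                {p : P.carrier | X p ⊆ A} ∪ {p : P.carrier | X p ⊆ B} := by
              ext p
              obtain ⟨x, hx⟩ := hXne p
              refine ⟨fun h => (h hx).imp (hXd hA hx) (hXd hB hx), ?_⟩
              rintro (h | h)
              exacts [Subset.trans h subset_union_left, Subset.trans h subset_union_right]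
            rw [this]; exact .union ihA ihB
          | @deriv B hB ih =>
            have : {p : P.carrier | X p ⊆ derivedSet B} =
                P.deriv {p : P.carrier | X p ⊆ B} := by
              ext p
              obtain ⟨x, hx⟩ := hXne p
              constructor
              · intro h
                have hxB := h hx
                rw [hQ B hB, derivedSet_biUnion (toFinite _)] at hxB
                obtain ⟨q, hq, hxq⟩ := mem_iUnion₂.1 hxB
                exact ⟨q, hq, (hlt hx).1 hxq⟩
              · rintro ⟨q, hq, hpq⟩
                exact Subset.trans hpq (derivedSet_mono _ _ hq)
            rw [this]; exact .deriv ih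
        intro A
        have := key (⋃ p ∈ A, X p) (TBAGen.biUnion (toFinite A) fun p _ => hXg p)
        convert this using 1
        ext p
        refine ⟨fun hp => subset_biUnion_of_mem (u := X) hp, fun hp => ?_⟩
        obtain ⟨x, hx⟩ := hXne p
        obtain ⟨q, hq, hxq⟩ := mem_iUnion₂.1 (hp hx)
        exact hXinj hx hxq ▸ hq }
  exact ⟨t, X, hE, fun i => hQ _ (.basic ⟨i, rfl⟩)⟩

end Tuple

/-! ### Invariant subsets of the Stone space -/

section Invariant

variable {R : Type u} [NonUnitalRing R] {n : ℕ} {J : Fin n → TwoSidedIdeal R}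

variable (J) in
/-- The set `A` is mapped onto itself by all automorphisms of the ring with its ideals. -/
def IsInvariant (A : Set (StoneSpace R)) : Prop :=
  ∀ g : R ≃+* R, (∀ i a, a ∈ J i ↔ g a ∈ J i) → stoneHomeomorph g '' A = A

variable (J) in
/-- The automorphisms of the ring with its ideals have finitely many orbits of ring elements. -/
def FinitelyManyOrbits : Prop :=
  ∃ (T : Type u) (_ : Finite T) (τ : R → T), ∀ a b, τ a = τ b →
    ∃ g : R ≃+* R, (∀ i a, a ∈ J i ↔ g a ∈ J i) ∧ g a = b

theorem image_basicOpen (g : R ≃+* R) (a : R) :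
    stoneHomeomorph g '' basicOpen a = basicOpen (g a) := by
  ext y
  obtain ⟨x, rfl⟩ := (stoneHomeomorph g).surjective y
  rw [(stoneHomeomorph g).injective.mem_set_image, stoneHomeomorph_mem]

theorem IsInvariant.derivedSet {A : Set (StoneSpace R)} (hA : IsInvariant J A) :
    IsInvariant J (derivedSet A) := by
  intro g hg
  have h1 := (stoneHomeomorph g).continuous.image_derivedSet (stoneHomeomorph g).injective (A := A)
  rw [hA g hg] at h1
  have h2 := (stoneHomeomorph g).symm.continuous.image_derivedSet
    (stoneHomeomorph g).symm.injective (A := A)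
  have h3 : (stoneHomeomorph g).symm '' A = A := by
    conv_lhs => rw [← hA g hg]
    simp [image_image]
  rw [h3] at h2
  refine h1.antisymm fun x hx => ⟨(stoneHomeomorph g).symm x, h2 ⟨x, hx, rfl⟩, by simp⟩

/-- An invariant closed set is determined by the orbits of the ring elements whose basic open sets
miss it. -/
theorem FinitelyManyOrbits.finite_invariant_closed (hJ : FinitelyManyOrbits J) :
    {C : Set (StoneSpace R) | IsClosed C ∧ IsInvariant J C}.Finite := by
  obtain ⟨T, _, τ, hτ⟩ := hJ
  refine Finite.of_finite_image (f := fun C => τ '' {a | Disjoint (basicOpen a) C})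
    (toFinite _) ?_
  have key : ∀ C C' : Set (StoneSpace R), IsInvariant J C' → IsClosed C →
      τ '' {a | Disjoint (basicOpen a) C} = τ '' {a | Disjoint (basicOpen a) C'} → C' ⊆ C := by
    intro C C' hC' hC h x hx
    by_contra hxC
    obtain ⟨a, ha, haC⟩ := exists_basicOpen_subset hC.isOpen_compl hxC
    have : τ a ∈ τ '' {a | Disjoint (basicOpen a) C'} :=
      h ▸ ⟨a, disjoint_left.2 fun y hy => haC hy, rfl⟩
    obtain ⟨b, hb, hba⟩ := this
    obtain ⟨g, hg, hgb⟩ := hτ b a hba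
    have hd : Disjoint (stoneHomeomorph g '' basicOpen b) (stoneHomeomorph g '' C') :=
      (disjoint_image_iff (stoneHomeomorph g).injective).2 hb
    rw [image_basicOpen, hgb, hC' g hg] at hd
    exact disjoint_left.1 hd ha hx
  rintro C ⟨hC, hCi⟩ C' ⟨hC', hCi'⟩ h
  exact (key C' C hCi hC' h.symm).antisymm (key C C' hCi' hC h)

/-- The closed sets of the ideals generate a finite sub-TBA, all members of which are invariant:
derivatives are closed and invariant, hence are among finitely many sets. -/
theorem FinitelyManyOrbits.finite_tbaGen (hJ : FinitelyManyOrbits J) :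
    {A | TBAGen derivedSet (range fun i => closedSet (J i)) A}.Finite ∧
      ∀ A, TBAGen derivedSet (range fun i => closedSet (J i)) A → IsInvariant J A := by
  set 𝒞 : Set (Set (StoneSpace R)) := {C | IsClosed C ∧ IsInvariant J C}
  have h𝒞 : 𝒞.Finite := hJ.finite_invariant_closed
  -- the sets that are unions of classes of points not separated by members of `𝒞`
  let Sat : Set (StoneSpace R) → Prop := fun A =>
    ∀ x y, (∀ C ∈ 𝒞, x ∈ C ↔ y ∈ C) → (x ∈ A ↔ y ∈ A)
  have hinv : ∀ A, Sat A → IsInvariant J A := by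
    intro A hA g hg
    ext y
    obtain ⟨x, rfl⟩ := (stoneHomeomorph g).surjective y
    rw [(stoneHomeomorph g).injective.mem_set_image]
    refine hA _ _ fun C hC => ?_
    conv_rhs => rw [← hC.2 g hg]
    rw [(stoneHomeomorph g).injective.mem_set_image]
  have hsat : ∀ A, TBAGen derivedSet (range fun i => closedSet (J i)) A → Sat A := by
    intro A hA
    induction hA with
    | basic h =>
      obtain ⟨i, rfl⟩ := h
      exact fun x y h => h _ ⟨isClosed_closedSet _, fun g hg => image_closedSet g (hg i)⟩
    | univ => exact fun _ _ _ => Iff.rfl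
    | compl _ ih => exact fun x y h => not_congr (ih x y h)
    | union _ _ ih₁ ih₂ => exact fun x y h => or_congr (ih₁ x y h) (ih₂ x y h)
    | deriv _ ih => exact fun x y h => h _ ⟨isClosed_derivedSet _, (hinv _ ih).derivedSet⟩
  refine ⟨?_, fun A hA => hinv A (hsat A hA)⟩
  have hfin : {A | Sat A}.Finite := by
    let cls : StoneSpace R → Set (Set (StoneSpace R)) := fun x => {C ∈ 𝒞 | x ∈ C}
    refine Finite.of_finite_image (f := fun A => cls '' A)
      (h𝒞.finite_subsets.finite_subsets.subset ?_) ?_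
    · rintro _ ⟨A, -, rfl⟩ _ ⟨x, -, rfl⟩ C hC
      exact hC.1
    · have key : ∀ A B, Sat B → cls '' A = cls '' B → A ⊆ B := by
        intro A B hB h x hx
        have : cls x ∈ cls '' B := h ▸ ⟨x, hx, rfl⟩
        obtain ⟨y, hy, hyx⟩ := this
        refine (hB y x fun C hC => ?_).1 hy
        have := congrArg (C ∈ ·) hyx
        simpa [cls, hC] using this
      exact fun A hA B hB h => (key A B hB h).antisymm (key B A hA h.symm)
  exact hfin.subset hsat

/-- An infinite discrete invariant set has traces of every finite cardinality on the compact open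
sets, which then lie in different orbits. -/
theorem FinitelyManyOrbits.finite_of_discrete (hJ : FinitelyManyOrbits J) {A : Set (StoneSpace R)}
    (hA : IsInvariant J A) (hd : Disjoint A (derivedSet A)) : A.Finite := by
  obtain ⟨T, _, τ, hτ⟩ := hJ
  by_contra hinf
  have h1 : ∀ x ∈ A, ∃ a, x ∈ basicOpen a ∧ ∀ y ∈ A, y ∈ basicOpen a → y = x := by
    intro x hx
    have := disjoint_left.1 hd hx
    rw [mem_derivedSet_iff] at this
    push Not at this
    obtain ⟨a, ha, h⟩ := this
    exact ⟨a, ha, fun y hy hya => by_contra fun hyx => h y hy hyx hya⟩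
  choose! a ha ha' using h1
  have h2 : ∀ k : ℕ, ∃ b, (basicOpen b ∩ A).encard = k := by
    intro k
    obtain ⟨F, hFA, hF⟩ := exists_subset_encard_eq (s := A) (k := (k : ℕ∞))
      (by rw [encard_eq_top_iff.2 hinf]; exact le_top)
    have hFfin : F.Finite := finite_of_encard_eq_coe hF
    obtain ⟨b, hb⟩ := exists_basicOpen_eq (U := ⋃ x ∈ F, basicOpen (a x))
      (hFfin.isCompact_biUnion fun x _ => isCompact_basicOpen _)
      (isOpen_biUnion fun x _ => isOpen_basicOpen _)
    refine ⟨b, ?_⟩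
    rw [← hF, hb]
    congr 1
    ext y
    constructor
    · rintro ⟨hy, hyA⟩
      obtain ⟨x, hx, hyx⟩ := mem_iUnion₂.1 hy
      rwa [ha' x (hFA hx) y hyA hyx]
    · exact fun hy => ⟨mem_iUnion₂.2 ⟨y, hy, ha y (hFA hy)⟩, hFA hy⟩
  choose b hb using h2
  have hinj : Function.Injective fun k => τ (b k) := by
    intro k l hkl
    obtain ⟨g, hg, hgb⟩ := hτ _ _ hkl
    have : basicOpen (b l) ∩ A = stoneHomeomorph g '' (basicOpen (b k) ∩ A) := by
      rw [image_inter (stoneHomeomorph g).injective, image_basicOpen, hgb, hA g hg]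
    have h3 := hb l
    rw [this, (stoneHomeomorph g).injective.encard_image, hb k] at h3
    exact_mod_cast h3
  exact not_injective_infinite_finite _ hinj

end Invariant

/-! ### Isomorphisms of first-order structures and of rings with ideals -/

section Structures

variable {n : ℕ}

instance : Countable (Σ l, (idealLang n).Functions l) := by
  have : Countable (Σ l, RngFunc l) := by
    let g : (Σ l, RngFunc l) → Fin 4 := fun
      | ⟨_, .zero⟩ => 0
      | ⟨_, .neg⟩ => 1
      | ⟨_, .add⟩ => 2
      | ⟨_, .mul⟩ => 3
    refine (show Function.Injective g from ?_).countable
    rintro ⟨_, a⟩ ⟨_, b⟩ h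
    cases a <;> cases b <;> simp [g] at h <;> rfl
  exact this

instance : Countable (Σ l, (idealLang n).Relations l) := by
  have : Countable (Σ l, IdealRel n l) := by
    refine (show Function.Surjective
      (fun i => ⟨1, IdealRel.mem i⟩ : Fin n → Σ l, IdealRel n l) from ?_).countable
    rintro ⟨_, ⟨i⟩⟩
    exact ⟨i, rfl⟩
  exact this

variable {R R' : Type u} [NonUnitalRing R] [NonUnitalRing R'] {J : Fin n → TwoSidedIdeal R}
  {J' : Fin n → TwoSidedIdeal R'}

theorem exists_ringEquiv_of_equiv
    (e : @FirstOrder.Language.Equiv (idealLang n) R R' (idealStructure J) (idealStructure J')) :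
    ∃ g : R ≃+* R', (∀ i a, a ∈ J i ↔ g a ∈ J' i) ∧ ∀ a, g a = e.toFun a := by
  let := idealStructure J
  let := idealStructure J'
  refine ⟨{ e.toEquiv with map_mul' := fun a b => ?_, map_add' := fun a b => ?_ },
    fun i a => ?_, fun a => rfl⟩
  · exact e.map_fun' RngFunc.mul ![a, b]
  · exact e.map_fun' RngFunc.add ![a, b]
  · exact (e.map_rel' (IdealRel.mem i) ![a]).symm

/-- A ring isomorphism carrying ideals to ideals is an isomorphism of first-order structures. -/
def equivOfRingEquiv (g : R ≃+* R') (hg : ∀ i a, a ∈ J i ↔ g a ∈ J' i) :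
    @FirstOrder.Language.Equiv (idealLang n) R R' (idealStructure J) (idealStructure J') :=
  let _ := idealStructure J
  let _ := idealStructure J'
  { g.toEquiv with
    map_fun' := fun {k} f x => by
      cases (f : RngFunc k) with
      | zero => exact map_zero g
      | neg => exact map_neg g _
      | add => exact map_add g _ _
      | mul => exact map_mul g _ _
    map_rel' := fun {k} r x => by
      cases (r : IdealRel n k) with
      | mem i => exact (hg i _).symm }

end Structures

/-! ### The correspondence -/

/-- Every countable omega-categorical Boolean ring with ideals is described by a tuple. -/
theorem CatIdealSystem.exists_describes {n : ℕ} (S : CatIdealSystem.{u} n) :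
    ∃ t : POTuple.{v} n, Describes t S.toIdealSystem := by
  have := S.countable
  have : Nonempty S.carrier := ⟨0⟩
  have hJ : FinitelyManyOrbits S.ideal := by
    let := idealStructure S.ideal
    obtain ⟨T, hT, τ, hτ⟩ := S.categorical.finite_orbits
    refine ⟨T, hT, τ, fun a b hab => ?_⟩
    obtain ⟨e, he⟩ := hτ a b hab
    obtain ⟨g, hg, hge⟩ := exists_ringEquiv_of_equiv e
    exact ⟨g, hg, (hge a).trans he⟩
  obtain ⟨hfin, hinv⟩ := hJ.finite_tbaGen
  obtain ⟨t, X, hX, hC⟩ := exists_tuple (fun i => isClosed_closedSet (S.ideal i)) hfin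
    fun A hA hd => hJ.finite_of_discrete (hinv A hA) hd
  exact ⟨t, describes_iff.2 ⟨X, hX, hC⟩⟩

theorem mem_ideal_iff_of_partition {n : ℕ} {t : POTuple.{v} n} {S : IdealSystem.{u} n}
    {X : t.carrier → Set (StoneSpace S.carrier)}
    (hC : ∀ i, closedSet (S.ideal i) = ⋃ p ∈ t.Q i, X p) (i : Fin n) (a : S.carrier) :
    a ∈ S.ideal i ↔ ∀ p ∈ t.Q i, ¬(basicOpen a ∩ X p).Nonempty := by
  rw [mem_ideal_iff S.mul_self, hC, disjoint_iUnion₂_right]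
  simp only [disjoint_iff_inter_eq_empty, not_nonempty_iff_eq_empty]

/-- A tuple describes at most one countable Boolean ring with ideals up to isomorphism. -/
theorem Describes.iso_right {n : ℕ} {t : POTuple.{v} n} {S S' : IdealSystem.{u} n}
    [Countable S.carrier] [Countable S'.carrier] (h : Describes t S) (h' : Describes t S') :
    S.Iso S' := by
  obtain ⟨X, hX, hC⟩ := describes_iff.1 h
  obtain ⟨X', hX', hC'⟩ := describes_iff.1 h'
  obtain ⟨e, -, he⟩ := (similarTuple_elim0 t.finiteCrowded hX hX').exists_ringEquiv S.mul_self
    S'.mul_self t.finiteCrowded hX hX'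
  refine ⟨e, fun i a => ?_⟩
  rw [mem_ideal_iff_of_partition hC, mem_ideal_iff_of_partition hC']
  exact forall₂_congr fun p _ => not_congr (he a p)

/-- A countable Boolean ring with ideals that is described by a tuple is omega-categorical: the
similarity types of tuples of ring elements are finite in number, and similar tuples are
conjugate. -/
theorem Describes.categorical {n : ℕ} {t : POTuple.{v} n} {S : IdealSystem.{u} n}
    [Countable S.carrier] (h : Describes t S) :
    @IsOmegaCategorical (idealLang n) S.carrier (idealStructure S.ideal) := by
  classical
  let := idealStructure S.ideal
  obtain ⟨X, hX, hC⟩ := describes_iff.1 h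
  have hE := t.finiteCrowded
  have := hE.1
  have : Nonempty S.carrier := ⟨0⟩
  have hXfin : ∀ p ∈ t.discrete, (X p).Finite := fun p hp => by
    rw [← encard_ne_top_iff, hX.card_eq ⟨p, hE.2 hp, hp⟩]
    exact ENat.natCast_ne_top _
  refine isOmegaCategorical_of_orbits.{u, v} fun k => ?_
  -- junk value `0` of the cardinality at the labels whose parts may be infinite
  let τ : (Fin k → S.carrier) → (Fin k → Prop) → t.carrier → Prop × ℕ × Prop := fun a ε p =>
    ((cell a ε ∩ X p).Nonempty, if p ∈ t.discrete then (cell a ε ∩ X p).ncard else 0,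
      IsCompact (closure (cell a ε ∩ X p)))
  have hτ : (range τ).Finite := by
    refine (Finite.pi' (ι := Fin k → Prop) fun ε => Finite.pi' (ι := t.carrier) fun p =>
      (finite_univ (α := Prop)).prod ((finite_Iic (X p).ncard).prod
        (finite_univ (α := Prop)))).subset ?_
    rintro _ ⟨a, rfl⟩ ε p
    refine ⟨mem_univ _, ?_, mem_univ _⟩
    simp only [τ, mem_Iic]
    split_ifs with hp
    · exact ncard_le_ncard inter_subset_right (hXfin p hp)
    · exact Nat.zero_le _
  refine ⟨range τ, hτ.to_subtype, fun a => ⟨τ a, a, rfl⟩, fun a b hab => ?_⟩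
  have hab' : ∀ ε p, τ a ε p = τ b ε p := fun ε p =>
    congrFun (congrFun (congrArg Subtype.val hab) ε) p
  have hsim : SimilarTuple X X a b := by
    intro ε
    refine ⟨fun p => iff_of_eq (congrArg Prod.fst (hab' ε p)), fun p hp => ?_,
      fun p => iff_of_eq (congrArg (fun z => z.2.2) (hab' ε p))⟩
    have h1 := congrArg (fun z => z.2.1) (hab' ε p)
    simp only [τ, hp, if_true] at h1
    rw [← ((hXfin p hp).subset inter_subset_right).cast_ncard_eq,
      ← ((hXfin p hp).subset inter_subset_right).cast_ncard_eq, h1]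
  obtain ⟨e, he, heX⟩ := hsim.exists_ringEquiv S.mul_self S.mul_self hE hX hX
  refine ⟨equivOfRingEquiv e fun i r => ?_, he⟩
  rw [mem_ideal_iff_of_partition hC, mem_ideal_iff_of_partition hC]
  exact forall₂_congr fun p _ => not_congr (heX r p)

end BooleanIdeals

theorem theorem5p1 (n : ℕ) :
    ∃ Φ : BooleanIdeals.CatIdealClass.{u} n ≃ BooleanIdeals.POTupleClass.{v} n,
      ∀ (S : BooleanIdeals.CatIdealSystem.{u} n) (t : BooleanIdeals.POTuple.{v} n),
        Φ (Quotient.mk (BooleanIdeals.CatIdealSystem.isoSetoid n) S) =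
            Quotient.mk (BooleanIdeals.POTuple.isoSetoid n) t ↔
          BooleanIdeals.Describes t S.toIdealSystem := by
  choose t ht using fun S : BooleanIdeals.CatIdealSystem.{u} n =>
    BooleanIdeals.CatIdealSystem.exists_describes.{u, v} S
  let F : BooleanIdeals.CatIdealClass.{u} n → BooleanIdeals.POTupleClass.{v} n :=
    Quotient.lift (fun S => Quotient.mk (BooleanIdeals.POTuple.isoSetoid n) (t S))
      fun S S' hSS' => Quotient.sound (((ht S).of_iso hSS').iso_left (ht S'))
  have hF : ∀ S t', F (Quotient.mk (BooleanIdeals.CatIdealSystem.isoSetoid n) S) =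
      Quotient.mk (BooleanIdeals.POTuple.isoSetoid n) t' ↔
        BooleanIdeals.Describes t' S.toIdealSystem := by
    intro S t'
    refine ⟨fun h => (ht S).of_iso_left (Quotient.exact h), fun h => ?_⟩
    exact Quotient.sound ((ht S).iso_left h)
  have hbij : Function.Bijective F := by
    constructor
    · intro a b
      induction a using Quotient.inductionOn with | _ S
      induction b using Quotient.inductionOn with | _ S'
      intro h
      have h' := (hF S (t S')).1 (h.trans ((hF S' (t S')).2 (ht S')))
      have := S.countable
      have := S'.countable
      exact Quotient.sound (h'.iso_right (ht S'))
    · intro b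
      induction b using Quotient.inductionOn with | _ s
      obtain ⟨S, _, hS⟩ := BooleanIdeals.exists_describes.{u, v} s
      exact ⟨Quotient.mk _ ⟨S, inferInstance, hS.categorical⟩, (hF _ _).2 hS⟩
  exact ⟨Equiv.ofBijective F hbij, hF⟩
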